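/- Let $k$ be a field of characteristic zero, $n\ge 0$, and let $A\in\mathrm{GL}_n(k(z))$, where $k(z)$ carries the automorphism $\sigma(h(z))=h(z+1)$. Let $X=\mathbb{A}^1_k\times\mathrm{GL}_{n,k}=\operatorname{Spec}k[z,Z_{ij},1/\det Z]$ and let $\sigma\colon X\dashrightarrow X$ be the rational map $\sigma(b,B)=(b+1,A(b)B)$. Let $U\subseteq X$ be the largest open subset on which $\sigma$ is defined as a map to $X$; for $x\in X(k)$ the orbit of $x$ is said to be defined if $x,\sigma(x),\sigma^2(x),\dots$ all lie in $U$. Put $\mathbb{N}=\{0,1,2,\dots\}$ and call a set $j+\mathbb{N}l$ with $j,l\in\mathbb{N}$ an arithmetic progression (one-point sets, $l=0$, are allowed). Let $\mathrm{Seq}_k$ be the ring of sequences $\mathbb{N}\to k$ with componentwise operations, two sequences being identified if they agree at all sufficiently large arguments. It is a difference ring under the left shift $\sigma(f)(i)=f(i+1)$, and it is a $k(z)$-algebra through the morphism of difference rings $h\mapsto(h(0),h(1),h(2),\dots)$. A *Picard–Vessiot extension of $k(z)$ for $\sigma(y)=Ay$ inside $\mathrm{Seq}_k$* is a $k(z)$-subalgebra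 $L\subseteq\mathrm{Seq}_k$ with $\sigma(L)\subseteq L$ such that - $L$ is a $\sigma$-pseudo field: there are $l\ge1$ and orthogonal idempotents $e_0,\dots,e_{l-1}\in L$ with $L=e_0L\oplus\dots\oplus e_{l-1}L$, $\sigma(e_0)=e_1,\dots,\sigma(e_{l-2})=e_{l-1},\ \sigma(e_{l-1})=e_0$, and every ring $e_iL$ a field; - there is $Y\in\mathrm{GL}_n(L)$ with $\sigma(Y)=AY$ such that $L$ is the total ring of fractions of $k(z)[Y_{ij}]$; - every $x\in L$ with $\sigma(x)=x$ comes from an element of $k(z)$ fixed by $\sigma$. Then the following three statements are equivalent: 1. For every $x=(b,B)\in X(k)$ with $b\in\mathbb{N}$ whose orbit is defined and every closed subvariety $Y\subseteq X$ (Zariski closed subset, not necessarily irreducible), the set $\{i\in\mathbb{N}\mid\sigma^i(x)\in Y\}$ is a finite union of arithmetic progressions. 2. There exists a point $x=(b,B)\in X(k)$ with $b\in\mathbb{N}$ whose orbit is defined such that for every closed subvariety $Y\subseteq X$ the set $\{i\in\mathbb{N}\mid\sigma^i(x)\in Y\}$ is a finite union of arithmetic progressions. 3. There exists a Picard–Vessiot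 extension of $k(z)$ for $\sigma(y)=Ay$ inside $\mathrm{Seq}_k$. -/

import Mathlib

open Polynomial

/-! ### Rational self-maps of an affine integral variety and their orbits -/

namespace AffineRationalMap

variable {k R : Type*} [Field k] [CommRing R] [Algebra k R]

/-- The closed point of `Spec R` underlying a `k`-point `x : R → k`. -/
def toPrime (x : R →ₐ[k] k) : PrimeSpectrum R :=
  ⟨RingHom.ker x, RingHom.ker_isPrime x⟩

/-- A rational map from `X = Spec R` to itself is given by its comorphism
`φ : R → Frac R = k(X)`. It is a morphism on the basic open set `D(s)` if `φ` takes values in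
`R[1/s]`. -/
def IsDefinedOnBasicOpen (φ : R →ₐ[k] FractionRing R) (s : R) : Prop :=
  ∀ f : R, ∃ (a : R) (m : ℕ),
    φ f * algebraMap R (FractionRing R) (s ^ m) = algebraMap R (FractionRing R) a

/-- The largest open subset of `X = Spec R` on which the rational map is defined. -/
def domain (φ : R →ₐ[k] FractionRing R) : TopologicalSpace.Opens (PrimeSpectrum R) :=
  ⨆ s : {s : R // IsDefinedOnBasicOpen φ s}, PrimeSpectrum.basicOpen s.1

open Classical in
/-- The value at the `k`-point `x` of a rational function `g = a / s` with `s(x) ≠ 0`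
(`0` if `g` is not regular at `x`). On an integral domain it does not depend on `a` and `s`. -/
noncomputable def valueAt (x : R →ₐ[k] k) (g : FractionRing R) : k :=
  if h : ∃ p : R × R, x p.2 ≠ 0 ∧
      g * algebraMap R (FractionRing R) p.2 = algebraMap R (FractionRing R) p.1 then
    x h.choose.1 / x h.choose.2
  else 0

theorem valueAt_eq (x : R →ₐ[k] k) {g : FractionRing R} {a s : R} (hs : x s ≠ 0)
    (h : g * algebraMap R (FractionRing R) s = algebraMap R (FractionRing R) a) :
    valueAt x g = x a / x s := by
  have hex : ∃ p : R × R, x p.2 ≠ 0 ∧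
      g * algebraMap R (FractionRing R) p.2 = algebraMap R (FractionRing R) p.1 := ⟨(a, s), hs, h⟩
  rw [valueAt, dif_pos hex]
  obtain ⟨h1, h2⟩ := hex.choose_spec
  rw [div_eq_div_iff h1 hs, ← map_mul, ← map_mul]
  congr 1
  apply IsFractionRing.injective R (FractionRing R)
  rw [map_mul, map_mul, ← h, ← h2]
  ring

theorem exists_fraction {φ : R →ₐ[k] FractionRing R} {x : R →ₐ[k] k}
    (hx : toPrime x ∈ domain φ) (f : R) :
    ∃ a s : R, x s ≠ 0 ∧
      φ f * algebraMap R (FractionRing R) s = algebraMap R (FractionRing R) a := by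
  obtain ⟨⟨s, hs⟩, hxs⟩ := TopologicalSpace.Opens.mem_iSup.mp hx
  obtain ⟨a, m, h⟩ := hs f
  refine ⟨a, s ^ m, ?_, h⟩
  have : x s ≠ 0 := fun h0 => hxs (RingHom.mem_ker.mpr h0)
  rw [map_pow]
  exact pow_ne_zero m this

/-- The image of a `k`-point in the domain of the rational map: `f ↦ (φ f)(x)`. -/
noncomputable def image (φ : R →ₐ[k] FractionRing R) (x : R →ₐ[k] k)
    (hx : toPrime x ∈ domain φ) : R →ₐ[k] k where
  toFun f := valueAt x (φ f)
  map_one' := by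
    rw [valueAt_eq x (a := 1) (s := 1) (by simp) (by simp)]; simp
  map_zero' := by
    rw [valueAt_eq x (a := 0) (s := 1) (by simp) (by simp)]; simp
  map_mul' f g := by
    obtain ⟨a, s, hs, h⟩ := exists_fraction hx f
    obtain ⟨b, t, ht, h'⟩ := exists_fraction hx g
    rw [valueAt_eq x hs h, valueAt_eq x ht h',
      valueAt_eq x (a := a * b) (s := s * t) (by simp [hs, ht])
        (by rw [map_mul, map_mul, map_mul, ← h, ← h']; ring)]
    rw [map_mul, map_mul, div_mul_div_comm]
  map_add' f g := by
    obtain ⟨a, s, hs, h⟩ := exists_fraction hx f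
    obtain ⟨b, t, ht, h'⟩ := exists_fraction hx g
    rw [valueAt_eq x hs h, valueAt_eq x ht h',
      valueAt_eq x (a := a * t + s * b) (s := s * t) (by simp [hs, ht])
        (by rw [map_add, map_mul, map_add, map_mul, map_mul, ← h, ← h']; ring)]
    rw [map_add, map_mul, map_mul, map_mul, div_add_div _ _ hs ht]
  commutes' c := by
    rw [valueAt_eq x (a := algebraMap k R c) (s := 1) (by simp)
      (by rw [AlgHom.commutes, map_one, mul_one, ← IsScalarTower.algebraMap_apply])]
    simp

open Classical in
/-- The rational map on `k`-points; a point outside the domain is (by convention) left fixed.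
It is only used along orbits that are defined. -/
noncomputable def step (φ : R →ₐ[k] FractionRing R) (x : R →ₐ[k] k) : R →ₐ[k] k :=
  if hx : toPrime x ∈ domain φ then image φ x hx else x

/-- The orbit of `x` is defined: `x`, `σ(x)`, `σ²(x)`, … all lie in the domain of `σ`. -/
def OrbitDefined (φ : R →ₐ[k] FractionRing R) (x : R →ₐ[k] k) : Prop :=
  ∀ i : ℕ, toPrime ((step φ)^[i] x) ∈ domain φ

/-- The times at which the orbit of `x` meets the subset `Y` of `X`. -/
def returnSet (φ : R →ₐ[k] FractionRing R) (x : R →ₐ[k] k) (Y : Set (PrimeSpectrum R)) : Set ℕ :=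
  {i : ℕ | toPrime ((step φ)^[i] x) ∈ Y}

end AffineRationalMap

/-- `S` is a finite union of arithmetic progressions `j + ℕ l` with `j, l ∈ ℕ`
(`l = 0`, a single point, is allowed). -/
def IsFiniteUnionOfAP (S : Set ℕ) : Prop :=
  ∃ P : Finset (ℕ × ℕ), S = ⋃ p ∈ P, {i : ℕ | ∃ m : ℕ, i = p.1 + m * p.2}

/-! ### The rational map `(b, B) ↦ (b + 1, A(b) B)` on `𝔸¹ × GLₙ` -/

namespace SkewMap

variable (k : Type*) [Field k] (n : ℕ)

/-- The generic matrix `Z` over `k[z]`. -/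
noncomputable abbrev genericMatrix : Matrix (Fin n) (Fin n) (MvPolynomial (Fin n × Fin n) k[X]) :=
  Matrix.mvPolynomialX (Fin n) (Fin n) k[X]

/-- The coordinate ring `k[z, Zᵢⱼ, 1/det Z]` of `X = 𝔸¹ × GLₙ`. -/
abbrev CoordRing : Type _ := Localization.Away (genericMatrix k n).det

theorem powers_det_le :
    Submonoid.powers (genericMatrix k n).det ≤
      nonZeroDivisors (MvPolynomial (Fin n × Fin n) k[X]) :=
  powers_le_nonZeroDivisors_of_noZeroDivisors (Matrix.det_mvPolynomialX_ne_zero (Fin n) k[X])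

instance : IsDomain (CoordRing k n) :=
  IsLocalization.isDomain_localization (powers_det_le k n)

/-- The function field `k(X)` of `X = 𝔸¹ × GLₙ`. -/
abbrev FunField : Type _ := FractionRing (CoordRing k n)

theorem algebraMap_injective : Function.Injective (algebraMap k[X] (FunField k n)) := by
  rw [IsScalarTower.algebraMap_eq k[X] (CoordRing k n) (FunField k n),
    IsScalarTower.algebraMap_eq k[X] (MvPolynomial (Fin n × Fin n) k[X]) (CoordRing k n)]
  exact (IsFractionRing.injective (CoordRing k n) (FunField k n)).comp
    ((IsLocalization.injective (CoordRing k n) (powers_det_le k n)).comp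
      (MvPolynomial.C_injective _ _))

/-- The inclusion `k(z) ⊆ k(X)`. -/
noncomputable def ratFuncHom : RatFunc k →ₐ[k] FunField k n :=
  RatFunc.liftAlgHom (IsScalarTower.toAlgHom k k[X] (FunField k n))
    (nonZeroDivisors_le_comap_nonZeroDivisors_of_injective _ (algebraMap_injective k n))

/-- The generic matrix `Z` over the function field `k(X)`. -/
noncomputable def genericMatrixFun : Matrix (Fin n) (Fin n) (FunField k n) :=
  (genericMatrix k n).map (algebraMap _ (FunField k n))

theorem isUnit_det_genericMatrixFun : IsUnit (genericMatrixFun k n).det := by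
  have h : (genericMatrixFun k n).det = algebraMap _ (FunField k n) (genericMatrix k n).det := by
    rw [RingHom.map_det]; rfl
  rw [h, IsScalarTower.algebraMap_apply _ (CoordRing k n) (FunField k n)]
  exact (IsLocalization.Away.algebraMap_isUnit (S := CoordRing k n) _).map _

variable {k n}

/-- The matrix `A Z` over the function field `k(X)`. -/
noncomputable def imageMatrix (A : GL (Fin n) (RatFunc k)) :
    Matrix (Fin n) (Fin n) (FunField k n) :=
  A.val.map (ratFuncHom k n) * genericMatrixFun k n

/-- The comorphism of `σ` on `k[z, Zᵢⱼ]`: `z ↦ z + 1`, `Z ↦ A Z`. -/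
noncomputable def comorphismAux (A : GL (Fin n) (RatFunc k)) :
    MvPolynomial (Fin n × Fin n) k[X] →+* FunField k n :=
  MvPolynomial.eval₂Hom
    (Polynomial.aeval (algebraMap k[X] (FunField k n) X + 1) : k[X] →ₐ[k] FunField k n).toRingHom
    (fun p => imageMatrix A p.1 p.2)

theorem comorphismAux_isUnit (A : GL (Fin n) (RatFunc k)) :
    IsUnit (comorphismAux A (genericMatrix k n).det) := by
  have h : comorphismAux A (genericMatrix k n).det = (imageMatrix A).det := by
    rw [RingHom.map_det]
    congr 1
    ext i j
    simp [comorphismAux, Matrix.mvPolynomialX]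
  have h' : (A.val.map (ratFuncHom k n)).det = ratFuncHom k n A.val.det :=
    (AlgHom.map_det (ratFuncHom k n) A.val).symm
  rw [h, imageMatrix, Matrix.det_mul, h']
  exact (((Matrix.isUnit_iff_isUnit_det _).mp A.isUnit).map _).mul
    (isUnit_det_genericMatrixFun k n)

/-- The rational map `σ : X ⇢ X`, `σ(b, B) = (b + 1, A(b) B)`, given by its comorphism
`k[z, Zᵢⱼ, 1/det Z] → k(X)`, `z ↦ z + 1`, `Z ↦ A Z`. -/
noncomputable def comorphism (A : GL (Fin n) (RatFunc k)) : CoordRing k n →ₐ[k] FunField k n :=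
  { IsLocalization.Away.lift (S := CoordRing k n) (genericMatrix k n).det
      (comorphismAux_isUnit A) with
    commutes' := fun c => by
      rw [IsScalarTower.algebraMap_apply k (MvPolynomial (Fin n × Fin n) k[X]) (CoordRing k n)]
      simp [comorphismAux, MvPolynomial.algebraMap_eq,
        IsScalarTower.algebraMap_apply k k[X] (MvPolynomial (Fin n × Fin n) k[X])] }

/-- The evaluation `k[z, Zᵢⱼ] → k` at `z = b`, `Z = B`. -/
noncomputable def pointAux (b : k) (B : GL (Fin n) k) :
    MvPolynomial (Fin n × Fin n) k[X] →+* k :=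
  MvPolynomial.eval₂Hom (Polynomial.evalRingHom b) (fun p => B.val p.1 p.2)

theorem pointAux_isUnit (b : k) (B : GL (Fin n) k) :
    IsUnit (pointAux b B (genericMatrix k n).det) := by
  have h : pointAux b B (genericMatrix k n).det = B.val.det := by
    rw [RingHom.map_det]
    congr 1
    ext i j
    simp [pointAux, Matrix.mvPolynomialX]
  rw [h]
  exact (Matrix.isUnit_iff_isUnit_det _).mp B.isUnit

/-- The `k`-point `(b, B)` of `X = 𝔸¹ × GLₙ`. -/
noncomputable def point (b : k) (B : GL (Fin n) k) : CoordRing k n →ₐ[k] k :=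
  { IsLocalization.Away.lift (S := CoordRing k n) (genericMatrix k n).det
      (pointAux_isUnit b B) with
    commutes' := fun c => by
      rw [IsScalarTower.algebraMap_apply k (MvPolynomial (Fin n × Fin n) k[X]) (CoordRing k n)]
      simp [pointAux, MvPolynomial.algebraMap_eq,
        IsScalarTower.algebraMap_apply k k[X] (MvPolynomial (Fin n × Fin n) k[X])] }

end SkewMap

/-! ### Picard–Vessiot extensions -/

/-- A difference ring `(L, σ)` is a `σ`-pseudo field if `L = e₀L ⊕ ⋯ ⊕ e_{l-1}L` for orthogonal
idempotents that `σ` permutes cyclically and such that each ring `eᵢL` is a field. -/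
def IsPseudoField (L : Type*) [CommRing L] (σ : L →+* L) : Prop :=
  ∃ (l : ℕ) (_ : NeZero l) (e : Fin l → L) (he : CompleteOrthogonalIdempotents e),
    (∀ i, σ (e i) = e (i + 1)) ∧ ∀ i, IsField (he.idem i).Corner

/-- `(L, σL)` is a Picard–Vessiot extension of the difference field `(K, σK)` for the system
`σ(y) = A y`. -/
structure IsPicardVessiotExtension {K L : Type*} [Field K] [CommRing L] [Algebra K L]
    (σK : K →+* K) (σL : L →+* L) {n : ℕ} (A : GL (Fin n) K) : Prop where
  map_algebraMap : ∀ c : K, σL (algebraMap K L c) = algebraMap K L (σK c)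
  isPseudoField : IsPseudoField L σL
  /-- `L` is the total ring of fractions of `K[Yᵢⱼ]` for a fundamental solution matrix `Y`. -/
  exists_fundamental : ∃ Y : GL (Fin n) L,
    Y.val.map σL = A.val.map (algebraMap K L) * Y.val ∧
    IsFractionRing (Algebra.adjoin K (Set.range fun p : Fin n × Fin n => Y.val p.1 p.2)) L
  constants : ∀ x : L, σL x = x → ∃ c : K, σK c = c ∧ algebraMap K L c = x

/-- The endomorphism `h(z) ↦ h(z + 1)` of `k(z)`. -/
noncomputable def ratFuncShift (k : Type*) [Field k] : RatFunc k →+* RatFunc k :=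
  RatFunc.mapRingHom (Polynomial.compRingHom (X + C 1 : k[X]))
    (nonZeroDivisors_le_comap_nonZeroDivisors_of_injective _ (by
      intro p q h
      have := congrArg (fun r : k[X] => r.comp (X - C 1)) h
      simpa [Polynomial.comp_assoc] using this))

/-! ### The ring of sequences -/

/-- The ring of sequences `ℕ → k`, where two sequences are identified if they agree at all large
enough arguments. -/
def SeqRing (k : Type*) : Type _ := Filter.Germ (Filter.atTop : Filter ℕ) k

namespace SeqRing

theorem exists_rep {k : Type*} (s : SeqRing k) :
    ∃ f : ℕ → k, (f : Filter.Germ (Filter.atTop : Filter ℕ) k) = s :=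
  Quotient.exists_rep s

variable {k : Type*} [Field k]

noncomputable instance : CommRing (SeqRing k) :=
  inferInstanceAs (CommRing (Filter.Germ (Filter.atTop : Filter ℕ) k))

/-- The class of a sequence. -/
def mk (f : ℕ → k) : SeqRing k := (f : Filter.Germ (Filter.atTop : Filter ℕ) k)

theorem mk_eq_mk {f g : ℕ → k} : mk f = mk g ↔ ∀ᶠ i in Filter.atTop, f i = g i :=
  Filter.Germ.coe_eq

/-- The left shift `(f(0), f(1), …) ↦ (f(1), f(2), …)`. -/
noncomputable def shift (k : Type*) [Field k] : SeqRing k →+* SeqRing k where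
  toFun s := Filter.Germ.compTendsto s (fun i : ℕ => i + 1) (Filter.tendsto_add_atTop_nat 1)
  map_one' := rfl
  map_zero' := rfl
  map_mul' s t := by
    obtain ⟨f, rfl⟩ := exists_rep s
    obtain ⟨g, rfl⟩ := exists_rep t
    rfl
  map_add' s t := by
    obtain ⟨f, rfl⟩ := exists_rep s
    obtain ⟨g, rfl⟩ := exists_rep t
    rfl

theorem shift_mk (f : ℕ → k) : shift k (mk f) = mk fun i => f (i + 1) := rfl

theorem eventually_eval_ne_zero [CharZero k] {p : k[X]} (hp : p ≠ 0) :
    ∀ᶠ i : ℕ in Filter.atTop, p.eval₂ (RingHom.id k) (i : k) ≠ 0 := by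
  rw [← Nat.cofinite_eq_atTop]
  have hfin : Set.Finite {i : ℕ | p.eval (i : k) = 0} := by
    refine Set.Finite.of_finite_image (f := fun i : ℕ => (i : k)) ?_
      (Nat.cast_injective.injOn)
    refine (Polynomial.finite_setOfPred_isRoot hp).subset ?_
    rintro _ ⟨i, hi, rfl⟩
    exact hi
  refine hfin.subset ?_
  intro i hi
  simpa [Polynomial.eval₂_id] using hi

/-- The embedding `h ↦ (h(0), h(1), h(2), …)` of `k(z)` into the ring of sequences; `h(i)` is
defined for all large enough `i`. -/
noncomputable def ofRatFunc (k : Type*) [Field k] [CharZero k] : RatFunc k →+* SeqRing k where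
  toFun h := mk fun i => RatFunc.eval (RingHom.id k) (i : k) h
  map_one' := by simp only [RatFunc.eval_one]; rfl
  map_zero' := by simp only [RatFunc.eval_zero]; rfl
  map_mul' x y := mk_eq_mk.mpr <| by
    filter_upwards [eventually_eval_ne_zero x.denom_ne_zero,
      eventually_eval_ne_zero y.denom_ne_zero] with i hx hy using RatFunc.eval_mul _ _ hx hy
  map_add' x y := mk_eq_mk.mpr <| by
    filter_upwards [eventually_eval_ne_zero x.denom_ne_zero,
      eventually_eval_ne_zero y.denom_ne_zero] with i hx hy using RatFunc.eval_add _ _ hx hy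

noncomputable instance [CharZero k] : Algebra (RatFunc k) (SeqRing k) := (ofRatFunc k).toAlgebra

end SeqRing

/-- There is a Picard–Vessiot extension of `k(z)` for `σ(y) = A y` inside the ring of sequences:
a `k(z)`-subalgebra of it, stable under the shift, which with the restricted shift is a
Picard–Vessiot extension. -/
def HasPicardVessiotInSeq {k : Type*} [Field k] [CharZero k] {n : ℕ}
    (A : GL (Fin n) (RatFunc k)) : Prop :=
  ∃ (L : Subalgebra (RatFunc k) (SeqRing k)) (hL : ∀ x ∈ L, SeqRing.shift k x ∈ L),
    IsPicardVessiotExtension (ratFuncShift k) ((SeqRing.shift k).restrict L L hL) A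

/-! Along a defined orbit of `(b, B)` the first coordinate at time `i` is `b + i`. Recording the
values of a regular function `f` at index `m = b + i` therefore gives a ring homomorphism `orbitSeq`
from the coordinate ring to the ring of sequences, compatible with `k[z]`. It sends the generic
matrix to a fundamental solution matrix of `σ(y) = Ay`. The return set of a hypersurface is, up to
translation by `b`, the zero set of such a sequence, and finite unions of progressions are exactly
the eventually periodic sets. A sequence has eventually periodic zeros of period `l` iff on each
class modulo `l` it is eventually zero or eventually nonzero (`IsDichotomous`). So the theorem
compares this dichotomy with the structure of a pseudo field.

From 2 to 3: let `S` be generated over `k(z)` by the entries of the fundamental matrix of the orbit.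
Up to a nonzero polynomial, a unit among sequences, its elements are orbit sequences, so each is
dichotomous. `S` is noetherian and shift-stable, so one period serves all of `S`
(`exists_forall_isDichotomous`), and the least such period separates residue classes
(`exists_separating_period`). Hence `S` contains elements supported on exactly one class. Inverting
the elements of `S` that are units among sequences yields the class idempotents, with a field on
each class. Shift-invariant sequences are constant, so no new constants appear.

From 3 to 1: two fundamental matrices differ by a shift-invariant, hence constant, matrix. The
extension `L` therefore contains the matrix of every orbit and its inverse, thus all orbit
sequences. The idempotents of `L` are eventually periodic, and an element of a field `eᵢL` is zero
or invertible, so elements of `L` are dichotomous (`isDichotomous_of_pseudoField`). Closed sets are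
finite intersections of hypersurfaces.

From 1 to 2: an orbit is defined once `b` exceeds all natural zeros of a common denominator of `A`
and `A⁻¹`. -/

/-! ### Eventually periodic sets of natural numbers -/

/-- `S` is periodic of some positive period from some point on. -/
def EventuallyPeriodic (S : Set ℕ) : Prop :=
  ∃ l : ℕ, 0 < l ∧ ∀ᶠ i in Filter.atTop, (i ∈ S ↔ i + l ∈ S)

namespace EventuallyPeriodic

theorem eventually_add_mul {S : Set ℕ} {l : ℕ}
    (h : ∀ᶠ i in Filter.atTop, (i ∈ S ↔ i + l ∈ S)) (m : ℕ) :
    ∀ᶠ i in Filter.atTop, (i ∈ S ↔ i + m * l ∈ S) := by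
  obtain ⟨N, hN⟩ := Filter.eventually_atTop.mp h
  refine Filter.eventually_atTop.mpr ⟨N, fun i hi => ?_⟩
  induction m with
  | zero => simp
  | succ m ih => rw [ih, hN (i + m * l) (by omega), add_mul, one_mul, add_assoc]

theorem congr {S T : Set ℕ} (hS : EventuallyPeriodic S)
    (h : ∀ᶠ i in Filter.atTop, (i ∈ S ↔ i ∈ T)) : EventuallyPeriodic T := by
  obtain ⟨l, hl, hS⟩ := hS
  refine ⟨l, hl, ?_⟩
  filter_upwards [hS, h, (Filter.tendsto_add_atTop_nat l).eventually h] with i h1 h2 h3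
  rw [← h2, ← h3, h1]

theorem of_eventually_notMem {S : Set ℕ} (h : ∀ᶠ i in Filter.atTop, i ∉ S) :
    EventuallyPeriodic S := by
  refine ⟨1, one_pos, ?_⟩
  filter_upwards [h, (Filter.tendsto_add_atTop_nat 1).eventually h] with i h1 h2
  exact iff_of_false h1 h2

theorem common_period {S T : Set ℕ} (hS : EventuallyPeriodic S) (hT : EventuallyPeriodic T) :
    ∃ l : ℕ, 0 < l ∧ ∀ᶠ i in Filter.atTop, (i ∈ S ↔ i + l ∈ S) ∧ (i ∈ T ↔ i + l ∈ T) := by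
  obtain ⟨l, hl, hS⟩ := hS
  obtain ⟨m, hm, hT⟩ := hT
  refine ⟨m * l, Nat.mul_pos hm hl, (eventually_add_mul hS m).and ?_⟩
  rw [mul_comm m l]
  exact eventually_add_mul hT l

theorem union {S T : Set ℕ} (hS : EventuallyPeriodic S) (hT : EventuallyPeriodic T) :
    EventuallyPeriodic (S ∪ T) := by
  obtain ⟨l, hl, h⟩ := common_period hS hT
  exact ⟨l, hl, h.mono fun i hi => or_congr hi.1 hi.2⟩

theorem inter {S T : Set ℕ} (hS : EventuallyPeriodic S) (hT : EventuallyPeriodic T) :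
    EventuallyPeriodic (S ∩ T) := by
  obtain ⟨l, hl, h⟩ := common_period hS hT
  exact ⟨l, hl, h.mono fun i hi => and_congr hi.1 hi.2⟩

theorem empty : EventuallyPeriodic ∅ := ⟨1, one_pos, by simp⟩

theorem univ : EventuallyPeriodic Set.univ := ⟨1, one_pos, by simp⟩

theorem biUnion_finset {ι : Type*} (s : Finset ι) {S : ι → Set ℕ}
    (h : ∀ i ∈ s, EventuallyPeriodic (S i)) : EventuallyPeriodic (⋃ i ∈ s, S i) := by
  classical
  induction s using Finset.induction_on with
  | empty => simpa using empty
  | insert a s ha ih =>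
    rw [Finset.set_biUnion_insert]
    exact (h a (by simp)).union (ih fun i hi => h i (by simp [hi]))

theorem biInter_finset {ι : Type*} (s : Finset ι) {S : ι → Set ℕ}
    (h : ∀ i ∈ s, EventuallyPeriodic (S i)) : EventuallyPeriodic (⋂ i ∈ s, S i) := by
  classical
  induction s using Finset.induction_on with
  | empty => simpa using univ
  | insert a s ha ih =>
    rw [Finset.set_biInter_insert]
    exact (h a (by simp)).inter (ih fun i hi => h i (by simp [hi]))

theorem preimage_add_iff {S : Set ℕ} (b : ℕ) :
    EventuallyPeriodic {i | i + b ∈ S} ↔ EventuallyPeriodic S := by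
  refine exists_congr fun l => and_congr_right fun _ => ?_
  conv_rhs => rw [← Filter.map_add_atTop_eq_nat b, Filter.eventually_map]
  simp only [Set.mem_ofPred_eq, add_right_comm]

theorem progression (j l : ℕ) : EventuallyPeriodic {i : ℕ | ∃ m : ℕ, i = j + m * l} := by
  rcases Nat.eq_zero_or_pos l with rfl | hl
  · refine of_eventually_notMem (Filter.eventually_atTop.mpr ⟨j + 1, ?_⟩)
    rintro i hi ⟨m, rfl⟩
    omega
  · refine ⟨l, hl, Filter.eventually_atTop.mpr ⟨j, fun i hi => ⟨?_, ?_⟩⟩⟩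
    · rintro ⟨m, rfl⟩
      exact ⟨m + 1, by ring⟩
    · rintro ⟨m, hm⟩
      -- The case `m = 0` would give `i + l = j`, impossible for `i ≥ j` and `l > 0`.
      rcases m with _ | m
      · omega
      · exact ⟨m, by rw [add_mul, one_mul] at hm; omega⟩

end EventuallyPeriodic

theorem isFiniteUnionOfAP_iff_eventuallyPeriodic {S : Set ℕ} :
    IsFiniteUnionOfAP S ↔ EventuallyPeriodic S := by
  classical
  constructor
  · rintro ⟨P, rfl⟩
    exact EventuallyPeriodic.biUnion_finset P fun p _ => EventuallyPeriodic.progression p.1 p.2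
  · rintro ⟨l, hl, h⟩
    obtain ⟨N, hN⟩ := Filter.eventually_atTop.mp h
    have key : ∀ (m : ℕ) (i : ℕ), N ≤ i → (i ∈ S ↔ i + m * l ∈ S) := by
      intro m i hi
      induction m with
      | zero => simp
      | succ m ih => rw [ih, hN (i + m * l) (by omega), add_mul, one_mul, add_assoc]
    -- Single points below `N`, where periodicity may fail, and one progression of step `l` for each
    -- element of `S` in the window `[N, N + l)`.
    refine ⟨((Finset.range N).filter (· ∈ S)).image (fun i => (i, 0)) ∪
      ((Finset.Ico N (N + l)).filter (· ∈ S)).image (fun i => (i, l)), ?_⟩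
    ext i
    simp only [Set.mem_iUnion, Finset.mem_union, Finset.mem_image, Finset.mem_filter,
      Finset.mem_range, Finset.mem_Ico, Set.mem_ofPred_eq, exists_prop]
    constructor
    · intro hi
      rcases lt_or_ge i N with hiN | hiN
      · exact ⟨(i, 0), Or.inl ⟨i, ⟨hiN, hi⟩, rfl⟩, 0, by simp⟩
      · have hdecomp : i = N + (i - N) % l + (i - N) / l * l := by
          have := Nat.mod_add_div (i - N) l
          rw [mul_comm] at this
          omega
        refine ⟨(N + (i - N) % l, l), Or.inr ⟨_, ⟨⟨by omega, ?_⟩, ?_⟩, rfl⟩, (i - N) / l, hdecomp⟩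
        · have := Nat.mod_lt (i - N) hl
          omega
        · rw [key ((i - N) / l) _ (by omega), ← hdecomp]
          exact hi
    · rintro ⟨_, ⟨j, ⟨-, hj⟩, rfl⟩ | ⟨j, ⟨⟨hj, -⟩, hjS⟩, rfl⟩, m, rfl⟩
      · simpa using hj
      · exact (key m j hj).mp hjS

/-! ### Sequences on residue classes -/

namespace SeqRing

variable {k : Type*} [Field k]

theorem mk_surjective : Function.Surjective (mk : (ℕ → k) → SeqRing k) := exists_rep

/-- Taking classes of sequences, as a ring homomorphism. -/
def mkHom (k : Type*) [Field k] : (ℕ → k) →+* SeqRing k where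
  toFun := mk
  map_one' := rfl
  map_zero' := rfl
  map_mul' _ _ := rfl
  map_add' _ _ := rfl

theorem mk_mul (f g : ℕ → k) : mk f * mk g = mk (f * g) := rfl

theorem mk_eq_zero {f : ℕ → k} : mk f = 0 ↔ ∀ᶠ i in Filter.atTop, f i = 0 := mk_eq_mk

theorem isUnit_mk {f : ℕ → k} : IsUnit (mk f) ↔ ∀ᶠ i in Filter.atTop, f i ≠ 0 := by
  constructor
  · intro h
    obtain ⟨t, ht⟩ := h.exists_right_inv
    obtain ⟨g, rfl⟩ := mk_surjective t
    filter_upwards [mk_eq_mk.mp ((mk_mul f g).symm.trans ht)] with i hi h0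
    simp [h0] at hi
  · intro h
    refine IsUnit.of_mul_eq_one (mk f⁻¹) ?_
    rw [mk_mul]
    exact mk_eq_mk.mpr (h.mono fun i hi => by simp [hi])

/-- A shift-invariant class of sequences is the class of a constant sequence. -/
theorem exists_const_of_shift_eq {s : SeqRing k} (h : shift k s = s) :
    ∃ c : k, s = mk fun _ => c := by
  obtain ⟨f, rfl⟩ := mk_surjective s
  rw [shift_mk, mk_eq_mk] at h
  obtain ⟨N, hN⟩ := Filter.eventually_atTop.mp h
  refine ⟨f N, mk_eq_mk.mpr (Filter.eventually_atTop.mpr ⟨N, fun i hi => ?_⟩)⟩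
  induction i, hi using Nat.le_induction with
  | base => rfl
  | succ i hi ih => rw [hN i hi, ih]

/-- The ideal of sequences that vanish at all large elements of the class of `j` modulo `l`. -/
def vanishingIdeal (k : Type*) [Field k] (l j : ℕ) : Ideal (SeqRing k) where
  carrier := {s | ∃ f : ℕ → k, mk f = s ∧ ∀ᶠ m in Filter.atTop, m ≡ j [MOD l] → f m = 0}
  zero_mem' := ⟨0, rfl, by simp⟩
  add_mem' := by
    rintro _ _ ⟨f, rfl, hf⟩ ⟨g, rfl, hg⟩
    refine ⟨f + g, rfl, ?_⟩
    filter_upwards [hf, hg] with m h1 h2 hm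
    simp [h1 hm, h2 hm]
  smul_mem' := by
    rintro s _ ⟨f, rfl, hf⟩
    obtain ⟨g, rfl⟩ := mk_surjective s
    refine ⟨g * f, rfl, ?_⟩
    filter_upwards [hf] with m h1 hm
    simp [h1 hm]

/-- The sequence has no zero at large elements of the class of `j` modulo `l`. -/
def NonvanishingOn (l j : ℕ) (s : SeqRing k) : Prop :=
  ∃ f : ℕ → k, mk f = s ∧ ∀ᶠ m in Filter.atTop, m ≡ j [MOD l] → f m ≠ 0

theorem mk_mem_vanishingIdeal {l j : ℕ} {f : ℕ → k} :
    mk f ∈ vanishingIdeal k l j ↔ ∀ᶠ m in Filter.atTop, m ≡ j [MOD l] → f m = 0 := by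
  constructor
  · rintro ⟨g, hg, h⟩
    filter_upwards [h, mk_eq_mk.mp hg] with m h1 h2 hm
    rw [← h2, h1 hm]
  · exact fun h => ⟨f, rfl, h⟩

theorem nonvanishingOn_mk {l j : ℕ} {f : ℕ → k} :
    NonvanishingOn l j (mk f) ↔ ∀ᶠ m in Filter.atTop, m ≡ j [MOD l] → f m ≠ 0 := by
  constructor
  · rintro ⟨g, hg, h⟩
    filter_upwards [h, mk_eq_mk.mp hg] with m h1 h2 hm
    rw [← h2]
    exact h1 hm
  · exact fun h => ⟨f, rfl, h⟩

theorem vanishingIdeal_congr {l i j : ℕ} (h : i ≡ j [MOD l]) :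
    vanishingIdeal k l i = vanishingIdeal k l j := by
  ext s
  obtain ⟨f, rfl⟩ := mk_surjective s
  rw [mk_mem_vanishingIdeal, mk_mem_vanishingIdeal]
  exact Filter.eventually_congr (.of_forall fun m => imp_congr_left
    ⟨fun h' => h'.trans h, fun h' => h'.trans h.symm⟩)

theorem vanishingIdeal_le_of_dvd {l m j : ℕ} (h : l ∣ m) :
    vanishingIdeal k l j ≤ vanishingIdeal k m j := by
  intro s
  obtain ⟨f, rfl⟩ := mk_surjective s
  rw [mk_mem_vanishingIdeal, mk_mem_vanishingIdeal]
  exact fun hf => hf.mono fun i hi hij => hi (hij.of_dvd h)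

theorem shift_mem_vanishingIdeal {l j : ℕ} {s : SeqRing k} :
    shift k s ∈ vanishingIdeal k l j ↔ s ∈ vanishingIdeal k l (j + 1) := by
  obtain ⟨f, rfl⟩ := mk_surjective s
  rw [shift_mk, mk_mem_vanishingIdeal, mk_mem_vanishingIdeal]
  conv_rhs => rw [← Filter.map_add_atTop_eq_nat 1, Filter.eventually_map]
  exact Filter.eventually_congr (.of_forall fun m => imp_congr_left
    ⟨fun h => h.add_right 1, fun h => h.add_right_cancel' 1⟩)

theorem iterate_shift_mem_vanishingIdeal {l j : ℕ} (t : ℕ) {s : SeqRing k} :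
    (shift k)^[t] s ∈ vanishingIdeal k l j ↔ s ∈ vanishingIdeal k l (j + t) := by
  induction t generalizing s with
  | zero => rfl
  | succ t ih => rw [Function.iterate_succ_apply, ih, shift_mem_vanishingIdeal, add_assoc]

/-- On each residue class modulo `l` the sequence is eventually zero or eventually nonzero. -/
def IsDichotomous (l : ℕ) (s : SeqRing k) : Prop :=
  ∀ j, s ∈ vanishingIdeal k l j ∨ NonvanishingOn l j s

theorem isDichotomous_mk_iff {l : ℕ} (hl : 0 < l) {f : ℕ → k} :
    IsDichotomous l (mk f) ↔ ∀ᶠ i in Filter.atTop, (i ∈ {i | f i = 0} ↔ i + l ∈ {i | f i = 0}) := by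
  constructor
  · intro h
    have key : ∀ j ∈ Finset.range l, ∀ᶠ i in Filter.atTop, i ≡ j [MOD l] →
        (i ∈ {i | f i = 0} ↔ i + l ∈ {i | f i = 0}) := by
      intro j _
      rcases h j with h | h
      · rw [mk_mem_vanishingIdeal] at h
        filter_upwards [h, (Filter.tendsto_add_atTop_nat l).eventually h] with i h1 h2 hi
        exact iff_of_true (h1 hi) (h2 (by simpa [Nat.ModEq] using hi))
      · rw [nonvanishingOn_mk] at h
        filter_upwards [h, (Filter.tendsto_add_atTop_nat l).eventually h] with i h1 h2 hi
        exact iff_of_false (h1 hi) (h2 (by simpa [Nat.ModEq] using hi))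
    filter_upwards [(Filter.eventually_all_finset _).mpr key] with i hi
    exact hi (i % l) (Finset.mem_range.mpr (Nat.mod_lt _ hl)) (Nat.mod_modEq i l).symm
  · intro h j
    obtain ⟨N, hN⟩ := Filter.eventually_atTop.mp h
    have key : ∀ (m : ℕ) (i : ℕ), N ≤ i → (f i = 0 ↔ f (i + m * l) = 0) := by
      intro m i hi
      induction m with
      | zero => simp
      | succ m ih =>
        have := hN (i + m * l) (by omega)
        simp only [Set.mem_ofPred_eq] at this
        rw [ih, this, add_mul, one_mul, add_assoc]
    -- `j + N * l` is an element of the class of `j` beyond the threshold `N`; whether `f` vanishes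
    -- there decides the whole tail of the class.
    have hNl : N ≤ j + N * l := (Nat.le_mul_of_pos_right N hl).trans (Nat.le_add_left _ _)
    have hall : ∀ i, j + N * l ≤ i → i ≡ j [MOD l] → (f (j + N * l) = 0 ↔ f i = 0) := by
      intro i hi hij
      have : j + N * l ≡ i [MOD l] := by simpa [Nat.ModEq] using hij.symm
      obtain ⟨m, hm⟩ := (Nat.modEq_iff_dvd' hi).mp this
      rw [key m _ hNl, mul_comm m l, ← hm, Nat.add_sub_cancel' hi]
    rw [mk_mem_vanishingIdeal, nonvanishingOn_mk]
    by_cases h0 : f (j + N * l) = 0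
    · exact Or.inl (Filter.eventually_atTop.mpr ⟨_, fun i hi hij => (hall i hi hij).mp h0⟩)
    · exact Or.inr (Filter.eventually_atTop.mpr
        ⟨_, fun i hi hij => fun h1 => h0 ((hall i hi hij).mpr h1)⟩)

theorem exists_isDichotomous_mk_iff {f : ℕ → k} :
    (∃ l, 0 < l ∧ IsDichotomous l (mk f)) ↔ EventuallyPeriodic {i | f i = 0} :=
  exists_congr fun _ => and_congr_right fun hl => isDichotomous_mk_iff hl

theorem IsDichotomous.of_mul_isUnit {l : ℕ} {s u : SeqRing k} (h : IsDichotomous l (s * u)) (hl : 0 < l)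
    (hu : IsUnit u) : IsDichotomous l s := by
  obtain ⟨f, rfl⟩ := mk_surjective s
  obtain ⟨g, rfl⟩ := mk_surjective u
  rw [isUnit_mk] at hu
  rw [mk_mul, isDichotomous_mk_iff hl] at h
  rw [isDichotomous_mk_iff hl]
  filter_upwards [h, hu, (Filter.tendsto_add_atTop_nat l).eventually hu] with m h1 h2 h3
  simpa [h2, h3] using h1

theorem IsDichotomous.of_dvd {l m : ℕ} {s : SeqRing k} (hs : IsDichotomous l s) (h : l ∣ m) :
    IsDichotomous m s := by
  obtain ⟨f, rfl⟩ := mk_surjective s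
  refine fun j => (hs j).imp (fun h1 => vanishingIdeal_le_of_dvd h h1) fun h1 => ?_
  rw [nonvanishingOn_mk] at h1 ⊢
  exact h1.mono fun i hi hij => hi (hij.of_dvd h)

/-- A class modulo `g` splits into finitely many classes modulo `l`. By `h`, if `s` vanishes on one
of them it vanishes on all, and otherwise it is eventually nonzero on each, so the finitely many
tails can be glued. -/
theorem IsDichotomous.descend {l g : ℕ} (hl : 0 < l) {s : SeqRing k} (hs : IsDichotomous l s)
    (h : ∀ i j, i ≡ j [MOD g] → s ∈ vanishingIdeal k l i → s ∈ vanishingIdeal k l j)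
    (hgl : g ∣ l) : IsDichotomous g s := by
  obtain ⟨f, rfl⟩ := mk_surjective s
  have hrep : ∀ i j, i ≡ j [MOD g] → i % l ≡ j [MOD g] := fun i j hij =>
    ((Nat.mod_modEq i l).of_dvd hgl).trans hij
  intro j
  by_cases hj : ∃ i, i ≡ j [MOD g] ∧ mk f ∈ vanishingIdeal k l i
  · obtain ⟨i, hij, hi⟩ := hj
    left
    have key : ∀ r ∈ Finset.range l, ∀ᶠ m in Filter.atTop, r ≡ j [MOD g] → m ≡ r [MOD l] →
        f m = 0 := by
      intro r _
      by_cases hr : r ≡ j [MOD g]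
      · filter_upwards [mk_mem_vanishingIdeal.mp (h i r (hij.trans hr.symm) hi)] with m hm _ using hm
      · exact .of_forall fun m h' => absurd h' hr
    rw [mk_mem_vanishingIdeal]
    filter_upwards [(Filter.eventually_all_finset _).mpr key] with m hm hmj
    exact hm (m % l) (Finset.mem_range.mpr (Nat.mod_lt _ hl)) (hrep m j hmj)
      (Nat.mod_modEq m l).symm
  · push Not at hj
    right
    have key : ∀ r ∈ Finset.range l, ∀ᶠ m in Filter.atTop, r ≡ j [MOD g] → m ≡ r [MOD l] →
        f m ≠ 0 := by
      intro r _
      by_cases hr : r ≡ j [MOD g]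
      · filter_upwards [nonvanishingOn_mk.mp ((hs r).resolve_left (hj r hr))] with m hm _ using hm
      · exact .of_forall fun m h' => absurd h' hr
    rw [nonvanishingOn_mk]
    filter_upwards [(Filter.eventually_all_finset _).mpr key] with m hm hmj
    exact hm (m % l) (Finset.mem_range.mpr (Nat.mod_lt _ hl)) (hrep m j hmj)
      (Nat.mod_modEq m l).symm

/-! ### A common period for a shift-stable set of sequences -/

theorem iterate_shift_mem {S : Set (SeqRing k)} (hS : ∀ s ∈ S, shift k s ∈ S) (t : ℕ)
    {s : SeqRing k} (hs : s ∈ S) : (shift k)^[t] s ∈ S := by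
  induction t generalizing s with
  | zero => exact hs
  | succ t ih => exact ih (hS s hs)

/-- In a shift-stable set an inclusion of vanishing conditions may be translated. -/
theorem vanishing_translate {S : Set (SeqRing k)} (hS : ∀ s ∈ S, shift k s ∈ S) {l m i j : ℕ}
    (h : ∀ s ∈ S, s ∈ vanishingIdeal k l i → s ∈ vanishingIdeal k m j) (t : ℕ) {s : SeqRing k}
    (hs : s ∈ S) (hi : s ∈ vanishingIdeal k l (i + t)) : s ∈ vanishingIdeal k m (j + t) :=
  (iterate_shift_mem_vanishingIdeal t).mp
    (h _ (iterate_shift_mem hS t hs) ((iterate_shift_mem_vanishingIdeal t).mpr hi))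

/-- Vanishing on the multiples of `n!` becomes a weaker condition as `n` grows, so these ideals of
`S` form an ascending chain, which stabilises at some `N`. Every period divides some factorial, and
`N!` then works for all elements: shifts carry the comparison from the class of `0` to every class.
-/
theorem exists_forall_isDichotomous (S : Subring (SeqRing k)) [IsNoetherianRing S]
    (hS : ∀ s ∈ S, shift k s ∈ S) (h : ∀ s ∈ S, ∃ l, 0 < l ∧ IsDichotomous l s) :
    ∃ l, 0 < l ∧ ∀ s ∈ S, IsDichotomous l s := by
  let I : ℕ →o Ideal S :=
    { toFun := fun n => (vanishingIdeal k n.factorial 0).comap S.subtype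
      monotone' := fun m n hmn =>
        Ideal.comap_mono (vanishingIdeal_le_of_dvd (Nat.factorial_dvd_factorial hmn)) }
  obtain ⟨N, hN⟩ := monotone_stabilizes_iff_noetherian.mpr (inferInstance : IsNoetherian S S) I
  refine ⟨N.factorial, N.factorial_pos, fun s hs => ?_⟩
  obtain ⟨l, hl, hsl⟩ := h s hs
  have hM : IsDichotomous (max N l).factorial s :=
    hsl.of_dvd (Nat.dvd_factorial hl (le_max_right _ _))
  have hdvd : N.factorial ∣ (max N l).factorial := Nat.factorial_dvd_factorial (le_max_left _ _)
  have hle : ∀ s ∈ S, s ∈ vanishingIdeal k (max N l).factorial 0 →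
      s ∈ vanishingIdeal k N.factorial 0 := by
    intro s hs h1
    have : (⟨s, hs⟩ : S) ∈ I N := by
      rw [hN (max N l) (le_max_left _ _)]
      exact h1
    exact this
  refine hM.descend (Nat.factorial_pos _) (fun i j hij hi => ?_) hdvd
  -- Vanishing on the class of `i` modulo the large factorial spreads to the class of `i` modulo
  -- `N!`, which is that of `j`, and so to the smaller class of `j`.
  have h1 := vanishing_translate (S := (S : Set (SeqRing k))) hS hle i hs (by simpa using hi)
  rw [zero_add, vanishingIdeal_congr hij] at h1
  exact vanishingIdeal_le_of_dvd hdvd h1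

/-- There is a period for which moreover the vanishing conditions on different residue classes
are pairwise incomparable. -/
theorem exists_separating_period {S : Set (SeqRing k)} (hS : ∀ s ∈ S, shift k s ∈ S)
    (h : ∃ l, 0 < l ∧ ∀ s ∈ S, IsDichotomous l s) :
    ∃ l, 0 < l ∧ (∀ s ∈ S, IsDichotomous l s) ∧ ∀ i j, ¬ i ≡ j [MOD l] →
      ∃ s ∈ S, s ∈ vanishingIdeal k l i ∧ s ∉ vanishingIdeal k l j := by
  classical
  obtain ⟨hl, hdich⟩ := Nat.find_spec h
  have hmin : ∀ m, m < Nat.find h → ¬ (0 < m ∧ ∀ s ∈ S, IsDichotomous m s) := fun m hm =>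
    Nat.find_min h hm
  generalize Nat.find h = l at hl hdich hmin
  refine ⟨l, hl, hdich, fun i j hij => ?_⟩
  -- Take `l` minimal and let `d` represent `j - i`. If vanishing on `i` forces vanishing on `j`,
  -- then by shifting, vanishing on `r` forces it on every `r + t * d`, that is, on the whole class
  -- of `r` modulo `gcd d l`. This gcd is then a smaller period, against minimality.
  by_contra! hcon
  obtain ⟨d, hd⟩ : ∃ d, i + d ≡ j [MOD l] := by
    have hi : i ≤ j + l * i := (Nat.le_mul_of_pos_left i hl).trans (Nat.le_add_left _ _)
    exact ⟨j + l * i - i, by simp [Nat.add_sub_cancel' hi, Nat.ModEq]⟩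
  have hstep : ∀ r, ∀ s ∈ S, s ∈ vanishingIdeal k l r → s ∈ vanishingIdeal k l (r + d) := by
    intro r s hs hr
    have hi : i ≤ r + l * i := (Nat.le_mul_of_pos_left i hl).trans (Nat.le_add_left _ _)
    have h1 : i + (r + l * i - i) ≡ r [MOD l] := by
      simp [Nat.add_sub_cancel' hi, Nat.ModEq]
    have h2 := vanishing_translate hS hcon (r + l * i - i) hs (by rwa [vanishingIdeal_congr h1])
    have h3 : j + (r + l * i - i) ≡ r + d [MOD l] := by
      refine (hd.symm.add_right _).trans ?_
      rw [add_right_comm]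
      exact h1.add_right d
    rwa [vanishingIdeal_congr h3] at h2
  have hsteps : ∀ t r, ∀ s ∈ S, s ∈ vanishingIdeal k l r →
      s ∈ vanishingIdeal k l (r + t * d) := by
    intro t
    induction t with
    | zero => simp
    | succ t ih =>
      intro r s hs hr
      rw [add_mul, one_mul, ← add_assoc]
      exact hstep _ s hs (ih r s hs hr)
  have hg : 0 < Nat.gcd d l := Nat.gcd_pos_of_pos_right d hl
  have hlt : Nat.gcd d l < l := by
    refine lt_of_le_of_ne (Nat.gcd_le_right d hl) fun heq => hij ?_
    have : l ∣ d := heq ▸ Nat.gcd_dvd_left d l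
    obtain ⟨c, rfl⟩ := this
    simpa [Nat.ModEq] using hd
  refine hmin _ hlt ⟨hg, fun s hs => (hdich s hs).descend hl (fun a b hab ha => ?_)
    (Nat.gcd_dvd_right d l)⟩
  obtain ⟨t, ht⟩ : ∃ t : ℕ, a + t * d ≡ b [MOD l] := by
    have hdvd : ((Nat.gcd d l : ℕ) : ℤ) ∣ (b : ℤ) - a := Nat.modEq_iff_dvd.mp hab
    obtain ⟨c, hc⟩ := hdvd
    rw [Nat.gcd_eq_gcd_ab] at hc
    -- Bézout gives an integer solution; reducing it modulo `l` makes it a natural number.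
    refine ⟨((Nat.gcdA d l * c) % l).toNat, ?_⟩
    rw [← Int.natCast_modEq_iff]
    push_cast
    rw [Int.toNat_of_nonneg (Int.emod_nonneg _ (by exact_mod_cast hl.ne'))]
    have h1 : (a : ℤ) + (Nat.gcdA d l * c) % l * d ≡ a + (Nat.gcdA d l * c) * d [ZMOD l] :=
      ((Int.mod_modEq _ _).mul_right _).add_left _
    refine h1.trans (Int.modEq_iff_dvd.mpr ⟨Nat.gcdB d l * c, ?_⟩)
    linear_combination hc
  have := hsteps t a s hs ha
  rwa [vanishingIdeal_congr ht] at this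

end SeqRing

/-! ### Picard–Vessiot extensions inside the ring of sequences -/

namespace SeqRing

variable {k : Type*} [Field k]

/-- The indicator sequences of the residue classes modulo `l`. -/
def classIdempotent (k : Type*) [Field k] (l : ℕ) (i : Fin l) : ℕ → k :=
  fun m => if (m + i) % l = 0 then 1 else 0

theorem exists_unique_class {l : ℕ} [NeZero l] (m : ℕ) : ∃ i : Fin l, ∀ j : Fin l,
    (m + j) % l = 0 ↔ j = i := by
  have hl : 0 < l := Nat.pos_of_neZero l
  have hm := Nat.mod_lt m hl
  have huniq : ∀ i j : Fin l, (m + i) % l = 0 → (m + j) % l = 0 → j = i := by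
    intro i j hi hj
    have : (j : ℕ) ≡ i [MOD l] :=
      Nat.ModEq.add_left_cancel' m (show (m + j) % l = (m + i) % l by rw [hi, hj])
    exact Fin.ext (Nat.ModEq.eq_of_lt_of_lt this j.2 i.2)
  have hi : (m + (l - m % l) % l) % l = 0 := by
    rw [Nat.add_mod, Nat.mod_mod, ← Nat.add_mod]
    conv_lhs => rw [← Nat.mod_add_mod]
    rw [Nat.add_sub_cancel' hm.le, Nat.mod_self]
  exact ⟨⟨(l - m % l) % l, Nat.mod_lt _ hl⟩, fun j => ⟨fun hj => huniq _ _ hi hj, fun h => h ▸ hi⟩⟩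

/-- `l - i` is a natural representative of `-i`, the class on which the idempotent with index `i` is
supported. -/
theorem modEq_sub_iff {l : ℕ} (i : Fin l) (m : ℕ) : m ≡ l - i [MOD l] ↔ (m + i) % l = 0 := by
  have : l - (i : ℕ) + i = l := by omega
  rw [← Nat.ModEq.add_iff_right (Nat.ModEq.refl (i : ℕ)), this]
  simp [Nat.ModEq]

theorem completeOrthogonalIdempotents_classIdempotent {l : ℕ} [NeZero l] :
    CompleteOrthogonalIdempotents fun i => mk (classIdempotent k l i) := by
  refine CompleteOrthogonalIdempotents.map (f := mkHom k) (e := classIdempotent k l) ?_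
  rw [CompleteOrthogonalIdempotents.iff_ortho_complete]
  constructor
  · intro i j hij
    funext m
    obtain ⟨c, hc⟩ := exists_unique_class (l := l) m
    by_cases h : i = c
    · subst h
      simp [classIdempotent, hc, hij.symm]
    · simp [classIdempotent, hc, h]
  · funext m
    obtain ⟨c, hc⟩ := exists_unique_class (l := l) m
    simp [classIdempotent, hc]

/-- This fixes the sign in `classIdempotent`: the left shift moves the support from the class of
`-i` to that of `-(i + 1)`, so indices increase as a pseudo field requires. -/
theorem shift_classIdempotent {l : ℕ} [NeZero l] (i : Fin l) :
    shift k (mk (classIdempotent k l i)) = mk (classIdempotent k l (i + 1)) := by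
  rw [shift_mk]
  congr 1
  funext m
  have : (m + ((i + 1 : Fin l) : ℕ)) % l = (m + 1 + i) % l := by
    rw [Fin.val_add, Nat.add_mod_mod, Fin.val_one', ← Nat.add_assoc, Nat.add_mod_mod]
    congr 1
    omega
  simp only [classIdempotent, this]

variable [CharZero k]

theorem algebraMap_apply (h : RatFunc k) : algebraMap (RatFunc k) (SeqRing k) h =
    mk fun i : ℕ => RatFunc.eval (RingHom.id k) (i : k) h := rfl

theorem algebraMap_polynomial (p : k[X]) :
    algebraMap (RatFunc k) (SeqRing k) (algebraMap k[X] (RatFunc k) p) =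
      mk fun i : ℕ => p.eval (i : k) := by
  rw [algebraMap_apply]
  simp [RatFunc.eval_algebraMap]

theorem algebraMap_C (c : k) :
    algebraMap (RatFunc k) (SeqRing k) (RatFunc.C c) = mk fun _ => c := by
  rw [algebraMap_apply]
  simp

theorem ratFuncShift_algebraMap (p : k[X]) : ratFuncShift k (algebraMap k[X] (RatFunc k) p) =
    algebraMap k[X] (RatFunc k) (p.comp (X + C 1)) := by
  have := RatFunc.map_apply_div_ne_zero (φ := Polynomial.compRingHom (X + C 1 : k[X]))
    (nonZeroDivisors_le_comap_nonZeroDivisors_of_injective _ (by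
      intro p q h
      have := congrArg (fun r : k[X] => r.comp (X - C 1)) h
      simpa [Polynomial.comp_assoc] using this)) p 1 one_ne_zero
  simpa [ratFuncShift, RatFunc.coe_mapRingHom_eq_coe_map] using this

theorem shift_algebraMap (h : RatFunc k) : shift k (algebraMap (RatFunc k) (SeqRing k) h) =
    algebraMap (RatFunc k) (SeqRing k) (ratFuncShift k h) := by
  have : (shift k).comp (algebraMap (RatFunc k) (SeqRing k)) =
      (algebraMap (RatFunc k) (SeqRing k)).comp (ratFuncShift k) := by
    refine IsLocalization.ringHom_ext (nonZeroDivisors k[X]) (RingHom.ext fun p => ?_)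
    simp only [RingHom.comp_apply, ratFuncShift_algebraMap, algebraMap_polynomial, shift_mk]
    simp
  exact RingHom.congr_fun this h

/-! ### Fractions with unit denominators and the pseudo field they form -/

/-- The fractions of elements of `S` whose denominators are units in the ring of sequences. -/
def fractions (S : Subalgebra (RatFunc k) (SeqRing k)) : Subalgebra (RatFunc k) (SeqRing k) where
  carrier := {x | ∃ a ∈ S, ∃ s ∈ S, IsUnit s ∧ x * s = a}
  mul_mem' := by
    rintro x y ⟨a, ha, s, hs, hsu, h⟩ ⟨b, hb, t, ht, htu, h'⟩
    exact ⟨a * b, S.mul_mem ha hb, s * t, S.mul_mem hs ht, hsu.mul htu, by rw [← h, ← h']; ring⟩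
  add_mem' := by
    rintro x y ⟨a, ha, s, hs, hsu, h⟩ ⟨b, hb, t, ht, htu, h'⟩
    exact ⟨a * t + s * b, S.add_mem (S.mul_mem ha ht) (S.mul_mem hs hb), s * t, S.mul_mem hs ht,
      hsu.mul htu, by rw [← h, ← h']; ring⟩
  algebraMap_mem' h := ⟨_, S.algebraMap_mem h, 1, S.one_mem, isUnit_one, mul_one _⟩

theorem le_fractions (S : Subalgebra (RatFunc k) (SeqRing k)) : S ≤ fractions S :=
  fun x hx => ⟨x, hx, 1, S.one_mem, isUnit_one, mul_one _⟩

theorem inv_mem_fractions {S : Subalgebra (RatFunc k) (SeqRing k)} {x y : SeqRing k}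
    (hx : x ∈ S) (hxy : x * y = 1) : y ∈ fractions S :=
  ⟨1, S.one_mem, x, hx, IsUnit.of_mul_eq_one y hxy, by rw [mul_comm, hxy]⟩

theorem shift_mem_fractions {S : Subalgebra (RatFunc k) (SeqRing k)}
    (hS : ∀ s ∈ S, shift k s ∈ S) : ∀ x ∈ fractions S, shift k x ∈ fractions S := by
  rintro x ⟨a, ha, s, hs, hsu, h⟩
  exact ⟨_, hS a ha, _, hS s hs, hsu.map (shift k), by rw [← map_mul, h]⟩

section Separated

variable {S : Subalgebra (RatFunc k) (SeqRing k)} {l : ℕ}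

/-- An element of `S` whose support is a residue class. -/
theorem exists_support_eq_class [NeZero l] (hd : ∀ s ∈ S, IsDichotomous l s)
    (hsep : ∀ i j, ¬ i ≡ j [MOD l] → ∃ s ∈ S, s ∈ vanishingIdeal k l i ∧
      s ∉ vanishingIdeal k l j) (j : Fin l) :
    ∃ f : ℕ → k, mk f ∈ S ∧ ∀ᶠ m in Filter.atTop, f m ≠ 0 ↔ (m + j) % l = 0 := by
  classical
  have hne : ∀ i : Fin l, i ≠ j → ∃ f : ℕ → k, mk f ∈ S ∧
      ∀ᶠ m in Filter.atTop, ((m + i) % l = 0 → f m = 0) ∧ ((m + j) % l = 0 → f m ≠ 0) := by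
    intro i hij
    obtain ⟨s, hs, h1, h2⟩ := hsep (l - i) (l - j) (by
      rw [modEq_sub_iff]
      intro h
      obtain ⟨c, hc⟩ := exists_unique_class (l := l) (l - i)
      have : (l - (i : ℕ) + i) % l = 0 := by
        rw [Nat.sub_add_cancel i.2.le, Nat.mod_self]
      rw [hc] at h this
      exact hij (this.trans h.symm))
    obtain ⟨f, rfl⟩ := mk_surjective s
    refine ⟨f, hs, ?_⟩
    filter_upwards [mk_mem_vanishingIdeal.mp h1,
      nonvanishingOn_mk.mp ((hd _ hs _).resolve_left h2)] with m h3 h4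
    exact ⟨fun h => h3 ((modEq_sub_iff i m).mpr h), fun h => h4 ((modEq_sub_iff j m).mpr h)⟩
  choose! f hfS hf using hne
  -- Each factor kills one class other than that of `j` and has no zero on the class of `j`.
  refine ⟨∏ i ∈ Finset.univ.erase j, f i, ?_, ?_⟩
  · change mkHom k _ ∈ S
    rw [map_prod]
    exact S.prod_mem fun i hi => hfS i (Finset.ne_of_mem_erase hi)
  · filter_upwards [(Filter.eventually_all_finset (Finset.univ.erase j)).mpr
      fun i hi => hf i (Finset.ne_of_mem_erase hi)] with m hm
    rw [Finset.prod_apply, Finset.prod_ne_zero_iff]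
    constructor
    · intro h
      obtain ⟨c, hc⟩ := exists_unique_class (l := l) m
      rw [hc]
      by_contra hjc
      exact h c (by simp [Ne.symm hjc]) ((hm c (by simp [Ne.symm hjc])).1 ((hc c).mpr rfl))
    · exact fun h i hi => (hm i hi).2 h

/-- An element vanishing on a class is killed by an element of `S` supported on that class. A
nonzerodivisor of `S` thus vanishes on no class, and by dichotomy it is eventually nowhere zero.
This is why inverting only units among sequences produces the total ring of fractions. -/
theorem isUnit_of_mem_nonZeroDivisors [NeZero l] (hd : ∀ s ∈ S, IsDichotomous l s)
    (hsep : ∀ i j, ¬ i ≡ j [MOD l] → ∃ s ∈ S, s ∈ vanishingIdeal k l i ∧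
      s ∉ vanishingIdeal k l j) {s : SeqRing k} (hs : s ∈ S)
    (h : ∀ t ∈ S, s * t = 0 → t = 0) : IsUnit s := by
  obtain ⟨f, rfl⟩ := mk_surjective s
  have key : ∀ i : Fin l, ∀ᶠ m in Filter.atTop, (m + i) % l = 0 → f m ≠ 0 := by
    intro i
    rcases hd _ hs (l - i) with h1 | h1
    · exfalso
      obtain ⟨g, hg, hgi⟩ := exists_support_eq_class hd hsep i
      rw [mk_mem_vanishingIdeal] at h1
      have h2 := h _ hg (by
        rw [mk_mul, mk_eq_zero]
        filter_upwards [h1, hgi] with m h3 h4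
        by_cases hm : (m + i) % l = 0
        · simp [h3 ((modEq_sub_iff i m).mpr hm)]
        · have : g m = 0 := by
            by_contra h0
            exact hm (h4.mp h0)
          simp [this])
      rw [mk_eq_zero] at h2
      -- `N * l + (l - i)` is an index beyond `N` in the class of `-i`, where `g` cannot vanish.
      obtain ⟨N, hN⟩ := Filter.eventually_atTop.mp (h2.and hgi)
      have hl : N ≤ N * l := Nat.le_mul_of_pos_right N (Nat.pos_of_neZero l)
      obtain ⟨h3, h4⟩ := hN (N * l + (l - i)) (by omega)
      refine h4.mpr ?_ h3
      rw [add_assoc, Nat.sub_add_cancel i.2.le]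
      simp
    · exact (nonvanishingOn_mk.mp h1).mono fun m hm h => hm ((modEq_sub_iff i m).mpr h)
  rw [isUnit_mk]
  filter_upwards [Filter.eventually_all.mpr key] with m hm
  obtain ⟨c, hc⟩ := exists_unique_class (l := l) m
  exact hm c ((hc c).mpr rfl)

/-- If `f j` is supported exactly on the class with index `j`, then `∑ j, f j` is eventually nowhere
zero, and `f i / ∑ j, f j` is the idempotent. -/
theorem classIdempotent_mem_fractions [NeZero l] (hd : ∀ s ∈ S, IsDichotomous l s)
    (hsep : ∀ i j, ¬ i ≡ j [MOD l] → ∃ s ∈ S, s ∈ vanishingIdeal k l i ∧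
      s ∉ vanishingIdeal k l j) (i : Fin l) : mk (classIdempotent k l i) ∈ fractions S := by
  choose f hfS hf using exists_support_eq_class hd hsep
  have hall := Filter.eventually_all.mpr hf
  refine ⟨mk (f i), hfS i, mk (∑ j, f j), ?_, ?_, ?_⟩
  · change mkHom k _ ∈ S
    rw [map_sum]
    exact S.sum_mem fun j _ => hfS j
  · rw [isUnit_mk]
    filter_upwards [hall] with m hm
    obtain ⟨c, hc⟩ := exists_unique_class (l := l) m
    rw [Finset.sum_apply, Finset.sum_eq_single c]
    · exact (hm c).mpr ((hc c).mpr rfl)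
    · intro j _ hj
      by_contra h0
      exact hj ((hc j).mp ((hm j).mp h0))
    · simp
  · rw [mk_mul, mk_eq_mk]
    filter_upwards [hall] with m hm
    have h0 : ∀ j : Fin l, (m + j) % l ≠ 0 → f j m = 0 := fun j hj => by
      by_contra h0
      exact hj ((hm j).mp h0)
    by_cases hi : (m + i) % l = 0
    · obtain ⟨c, hc⟩ := exists_unique_class (l := l) m
      have hic := (hc i).mp hi
      subst hic
      rw [Pi.mul_apply, classIdempotent, if_pos hi, one_mul, Finset.sum_apply,
        Finset.sum_eq_single i (fun j _ hj => h0 j fun h => hj ((hc j).mp h)) (by simp)]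
    · rw [Pi.mul_apply, classIdempotent, if_neg hi, zero_mul, h0 i hi]

/-- Nonzero elements are invertible on each residue class. -/
theorem exists_inverse_on_class [NeZero l] (hd : ∀ s ∈ S, IsDichotomous l s)
    (hsep : ∀ i j, ¬ i ≡ j [MOD l] → ∃ s ∈ S, s ∈ vanishingIdeal k l i ∧
      s ∉ vanishingIdeal k l j) (i : Fin l) {x : SeqRing k} (hx : x ∈ fractions S)
    (h0 : mk (classIdempotent k l i) * x ≠ 0) :
    ∃ y ∈ fractions S, x * y = mk (classIdempotent k l i) := by
  obtain ⟨a, ha, s, hs, hsu, hxs⟩ := hx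
  obtain ⟨f, rfl⟩ := mk_surjective a
  have hf : ∀ᶠ m in Filter.atTop, (m + i) % l = 0 → f m ≠ 0 := by
    rcases hd _ ha (l - i) with h1 | h1
    · refine absurd ?_ h0
      refine hsu.mul_left_injective ?_
      simp only [zero_mul]
      rw [mul_assoc, hxs, mk_mul, mk_eq_zero]
      filter_upwards [mk_mem_vanishingIdeal.mp h1] with m hm
      by_cases hi : (m + i) % l = 0
      · simp [hm ((modEq_sub_iff i m).mpr hi)]
      · simp [classIdempotent, hi]
    · exact (nonvanishingOn_mk.mp h1).mono fun m hm h => hm ((modEq_sub_iff i m).mpr h)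
  choose g hgS hg using exists_support_eq_class hd hsep
  -- `T` equals `f * g i` on the class with index `i` and some nonzero `g j` elsewhere, so it is an
  -- element of `S` that is a unit among sequences.
  set T : ℕ → k := fun m => f m * g i m + ∑ j ∈ Finset.univ.erase i, g j m with hT
  have hTS : mk T ∈ S := by
    have : mk T = mk f * mk (g i) + ∑ j ∈ Finset.univ.erase i, mk (g j) := by
      change mkHom k T = mkHom k f * mkHom k (g i) + ∑ j ∈ Finset.univ.erase i, mkHom k (g j)
      rw [← map_sum, ← map_mul, ← map_add]
      congr 1
      funext m
      simp [hT]
    rw [this]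
    exact S.add_mem (S.mul_mem ha (hgS i)) (S.sum_mem fun j _ => hgS j)
  have hTval : ∀ᶠ m in Filter.atTop, ((m + i) % l = 0 → T m = f m * g i m) ∧ T m ≠ 0 := by
    filter_upwards [Filter.eventually_all.mpr hg, hf] with m hm hfm
    have h0 : ∀ j : Fin l, (m + j) % l ≠ 0 → g j m = 0 := fun j hj => by
      by_contra h0
      exact hj ((hm j).mp h0)
    obtain ⟨c, hc⟩ := exists_unique_class (l := l) m
    have h1 : (m + i) % l = 0 → T m = f m * g i m := by
      intro hi
      rw [hT]
      simp only
      rw [Finset.sum_eq_zero, add_zero]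
      intro j hj
      refine h0 j fun hj' => Finset.ne_of_mem_erase hj ?_
      rw [(hc j).mp hj', (hc i).mp hi]
    refine ⟨h1, ?_⟩
    by_cases hi : (m + i) % l = 0
    · rw [h1 hi]
      exact mul_ne_zero (hfm hi) ((hm i).mpr hi)
    · have hci : c ≠ i := fun h => hi ((hc i).mpr h.symm)
      rw [hT]
      simp only
      rw [h0 i hi, mul_zero, zero_add, Finset.sum_eq_single c]
      · exact (hm c).mpr ((hc c).mpr rfl)
      · exact fun j _ hj => h0 j fun h => hj ((hc j).mp h)
      · exact fun h => absurd (Finset.mem_erase.mpr ⟨hci, Finset.mem_univ c⟩) h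
  have hTu : IsUnit (mk T) := isUnit_mk.mpr (hTval.mono fun m hm => hm.2)
  obtain ⟨u, hu⟩ := hTu.exists_right_inv
  -- On the class, `x = f / s` and `T = f * g i`, so the inverse of `x` is `s * g i / T`, cut off by
  -- the idempotent.
  refine ⟨s * mk (g i) * mk (classIdempotent k l i) * u, ?_, ?_⟩
  · exact Subalgebra.mul_mem _ (Subalgebra.mul_mem _ (le_fractions S (S.mul_mem hs (hgS i)))
      (classIdempotent_mem_fractions hd hsep i)) (inv_mem_fractions hTS hu)
  · have h1 : mk f * mk (g i) * mk (classIdempotent k l i) =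
        mk T * mk (classIdempotent k l i) := by
      rw [mk_mul, mk_mul, mk_mul, mk_eq_mk]
      filter_upwards [hTval] with m hm
      by_cases hi : (m + i) % l = 0
      · simp [hm.1 hi]
      · simp [classIdempotent, hi]
    calc x * (s * mk (g i) * mk (classIdempotent k l i) * u)
        = x * s * mk (g i) * mk (classIdempotent k l i) * u := by ring
      _ = mk (classIdempotent k l i) * (mk T * u) := by rw [hxs, h1]; ring
      _ = _ := by rw [hu, mul_one]

end Separated

end SeqRing

namespace SeqRing

variable {k : Type*} [Field k]

theorem classIdempotent_ne_zero {l : ℕ} [NeZero l] (i : Fin l) :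
    mk (classIdempotent k l i) ≠ 0 := by
  rw [Ne, mk_eq_zero]
  intro h
  obtain ⟨N, hN⟩ := Filter.eventually_atTop.mp h
  have hl : N ≤ N * l := Nat.le_mul_of_pos_right N (Nat.pos_of_neZero l)
  have h1 := hN (N * l + (l - i)) (by omega)
  have : (N * l + (l - i) + i) % l = 0 := by
    rw [add_assoc, Nat.sub_add_cancel i.2.le]
    simp
  simp [classIdempotent, this] at h1

variable [CharZero k]

section Separated

variable {S : Subalgebra (RatFunc k) (SeqRing k)} {l : ℕ}

theorem isPseudoField_fractions [NeZero l] (hS : ∀ s ∈ S, shift k s ∈ S)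
    (hd : ∀ s ∈ S, IsDichotomous l s)
    (hsep : ∀ i j, ¬ i ≡ j [MOD l] → ∃ s ∈ S, s ∈ vanishingIdeal k l i ∧
      s ∉ vanishingIdeal k l j) :
    IsPseudoField (fractions S)
      ((shift k).restrict (fractions S) (fractions S) (shift_mem_fractions hS)) := by
  have hmem := classIdempotent_mem_fractions hd hsep
  have he : CompleteOrthogonalIdempotents
      (fun i => (⟨mk (classIdempotent k l i), hmem i⟩ : fractions S)) :=
    (CompleteOrthogonalIdempotents.map_injective_iff (fractions S).val.toRingHom
      Subtype.val_injective).mp completeOrthogonalIdempotents_classIdempotent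
  refine ⟨l, inferInstance, _, he, fun i => Subtype.ext (shift_classIdempotent i), fun i => ?_⟩
  refine ⟨⟨0, 1, fun h => ?_⟩, mul_comm, fun {a} ha => ?_⟩
  · exact classIdempotent_ne_zero (k := k) i
      (congrArg (fun x : (he.idem i).Corner => (x.1 : SeqRing k)) h).symm
  · obtain ⟨h1, h2⟩ := (Subsemigroup.mem_corner_iff (he.idem i)).mp a.2
    have h0 : mk (classIdempotent k l i) * (a.1 : SeqRing k) ≠ 0 := by
      intro h
      have h3 := congrArg (Subtype.val : fractions S → SeqRing k) h1
      exact ha (Subtype.ext (Subtype.ext (h3.symm.trans h)))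
    obtain ⟨y, hy, hxy⟩ := exists_inverse_on_class hd hsep i a.1.2 h0
    refine ⟨⟨⟨mk (classIdempotent k l i), hmem i⟩ * ⟨y, hy⟩ * ⟨mk (classIdempotent k l i), hmem i⟩,
      ⟨⟨y, hy⟩, rfl⟩⟩, Subtype.ext (Subtype.ext ?_)⟩
    have hidem := congrArg (Subtype.val : fractions S → SeqRing k) (he.idem i).eq
    change (a.1 : SeqRing k) * (mk (classIdempotent k l i) * y * mk (classIdempotent k l i)) =
      mk (classIdempotent k l i)
    change mk (classIdempotent k l i) * mk (classIdempotent k l i) =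
      mk (classIdempotent k l i) at hidem
    calc _ = ((a.1 : SeqRing k) * y) * (mk (classIdempotent k l i) * mk (classIdempotent k l i)) := by
          ring
      _ = _ := by rw [hxy, hidem, hidem]

end Separated

/-! ### From dichotomous sequences to a Picard–Vessiot extension -/

theorem shift_mem_adjoin {n : ℕ} {A : GL (Fin n) (RatFunc k)}
    {Y : Matrix (Fin n) (Fin n) (SeqRing k)}
    (hY : Y.map (shift k) = A.val.map (algebraMap (RatFunc k) (SeqRing k)) * Y) :
    ∀ s ∈ Algebra.adjoin (RatFunc k) (Set.range fun p : Fin n × Fin n => Y p.1 p.2),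
      shift k s ∈ Algebra.adjoin (RatFunc k) (Set.range fun p : Fin n × Fin n => Y p.1 p.2) := by
  intro s hs
  induction hs using Algebra.adjoin_induction with
  | mem x hx =>
    obtain ⟨⟨i, j⟩, rfl⟩ := hx
    have : shift k (Y i j) = (A.val.map (algebraMap (RatFunc k) (SeqRing k)) * Y) i j := by
      rw [← hY, Matrix.map_apply]
    simp only
    rw [this, Matrix.mul_apply]
    refine Subalgebra.sum_mem _ fun m _ => Subalgebra.mul_mem _ (Subalgebra.algebraMap_mem _ _) ?_
    exact Algebra.subset_adjoin ⟨(m, j), rfl⟩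
  | algebraMap r =>
    rw [shift_algebraMap]
    exact Subalgebra.algebraMap_mem _ _
  | add x y _ _ hx hy =>
    rw [map_add]
    exact Subalgebra.add_mem _ hx hy
  | mul x y _ _ hx hy =>
    rw [map_mul]
    exact Subalgebra.mul_mem _ hx hy

end SeqRing

-- The extension is `fractions S`, with `S` generated over `k(z)` by the entries of `Y`. Finite
-- generation makes `S` noetherian, which provides a separating period. The determinant of `Y` lies
-- in `S` and is a unit among sequences, so `Y` is invertible over `fractions S`.
open SeqRing in
theorem hasPicardVessiotInSeq_of_isDichotomous {k : Type*} [Field k] [CharZero k] {n : ℕ}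
    {A : GL (Fin n) (RatFunc k)} (Y : GL (Fin n) (SeqRing k))
    (hY : Y.val.map (shift k) = A.val.map (algebraMap (RatFunc k) (SeqRing k)) * Y.val)
    (h : ∀ s ∈ Algebra.adjoin (RatFunc k) (Set.range fun p : Fin n × Fin n => Y.val p.1 p.2),
      ∃ l, 0 < l ∧ IsDichotomous l s) : HasPicardVessiotInSeq A := by
  set S := Algebra.adjoin (RatFunc k) (Set.range fun p : Fin n × Fin n => Y.val p.1 p.2)
  have hS : ∀ s ∈ S, shift k s ∈ S := shift_mem_adjoin hY
  have : IsNoetherianRing S := by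
    exact isNoetherianRing_of_fg (Subalgebra.fg_def.mpr ⟨_, Set.finite_range _, rfl⟩)
  have : IsNoetherianRing S.toSubring := this
  obtain ⟨l, hl, hd, hsep⟩ := exists_separating_period (S := (S : Set (SeqRing k))) hS
    (exists_forall_isDichotomous S.toSubring hS h)
  have : NeZero l := ⟨hl.ne'⟩
  have hYS : ∀ i j, Y.val i j ∈ S := fun i j => Algebra.subset_adjoin ⟨(i, j), rfl⟩
  let YL : Matrix (Fin n) (Fin n) (fractions S) := fun i j => ⟨Y.val i j, le_fractions S (hYS i j)⟩
  have hdetS : Y.val.det ∈ S := by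
    rw [Matrix.det_apply]
    exact S.sum_mem fun σ _ => S.toSubring.zsmul_mem (S.prod_mem fun i _ => hYS _ _) _
  have hdet : IsUnit YL.det := by
    obtain ⟨u, hu⟩ := ((Matrix.isUnit_iff_isUnit_det _).mp Y.isUnit).exists_right_inv
    refine IsUnit.of_mul_eq_one ⟨u, inv_mem_fractions hdetS hu⟩ (Subtype.ext ?_)
    change ((fractions S).val YL.det) * u = 1
    rw [AlgHom.map_det]
    exact hu
  have hadj : ∀ x : fractions S,
      x ∈ Algebra.adjoin (RatFunc k) (Set.range fun p : Fin n × Fin n => YL p.1 p.2) ↔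
        (x : SeqRing k) ∈ S := by
    have hmap : (Algebra.adjoin (RatFunc k) (Set.range fun p : Fin n × Fin n => YL p.1 p.2)).map
        (fractions S).val = S := by
      rw [AlgHom.map_adjoin, ← Set.range_comp]
      rfl
    intro x
    refine Iff.trans ?_ (SetLike.ext_iff.mp hmap (x : SeqRing k))
    rw [Subalgebra.mem_map]
    exact ⟨fun hx => ⟨x, hx, rfl⟩, fun ⟨y, hy, hyx⟩ => by rwa [← Subtype.ext hyx]⟩
  refine ⟨fractions S, shift_mem_fractions hS, ?_, isPseudoField_fractions hS hd hsep,
    ⟨Matrix.GeneralLinearGroup.mk'' YL hdet, ?_, ?_⟩, ?_⟩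
  · exact fun c => Subtype.ext (shift_algebraMap c)
  · ext i j
    have h1 := congrFun (congrFun hY i) j
    rw [Matrix.map_apply, Matrix.mul_apply] at h1
    rw [Matrix.mul_apply]
    refine h1.trans (Eq.trans ?_ (map_sum (fractions S).val _ _).symm)
    rfl
  · refine ⟨?_, ?_, ?_⟩
    · rintro ⟨⟨x, hx⟩, hx0⟩
      have hxS : (x : SeqRing k) ∈ S := (hadj x).mp hx
      have hu : IsUnit (x : SeqRing k) := by
        refine isUnit_of_mem_nonZeroDivisors hd hsep hxS fun t ht h0 => ?_
        have h1 := (mem_nonZeroDivisors_iff_left.mp hx0)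
          ⟨⟨t, le_fractions S ht⟩, (hadj _).mpr ht⟩ (Subtype.ext (Subtype.ext h0))
        exact congrArg (fun x => ((Subtype.val x : fractions S) : SeqRing k)) h1
      obtain ⟨u, hu⟩ := hu.exists_right_inv
      exact IsUnit.of_mul_eq_one ⟨u, inv_mem_fractions hxS hu⟩ (Subtype.ext hu)
    · rintro ⟨x, a, ha, s, hs, hsu, hxs⟩
      refine ⟨(⟨⟨a, le_fractions S ha⟩, (hadj _).mpr ha⟩,
        ⟨⟨⟨s, le_fractions S hs⟩, (hadj _).mpr hs⟩, ?_⟩), Subtype.ext hxs⟩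
      rw [mem_nonZeroDivisors_iff_right]
      intro t ht
      have := congrArg (fun x => ((Subtype.val x : fractions S) : SeqRing k)) ht
      exact Subtype.ext (Subtype.ext (hsu.mul_left_eq_zero.mp this))
    · intro x y hxy
      exact ⟨1, by rw [Subtype.ext hxy]⟩
  · intro x hx
    obtain ⟨c, hc⟩ := exists_const_of_shift_eq (congrArg Subtype.val hx)
    refine ⟨RatFunc.C c, ?_, Subtype.ext ?_⟩
    · rw [← RatFunc.algebraMap_C, ratFuncShift_algebraMap, Polynomial.C_comp]
    · exact (algebraMap_C c).trans hc.symm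

/-! ### From a Picard–Vessiot extension to dichotomous sequences -/

namespace SeqRing

variable {k : Type*} [Field k]

/-- In a pseudo field inside the ring of sequences, each residue class modulo a suitable period
eventually consists of zeros or of nonzeros of a given element. -/
theorem isDichotomous_of_pseudoField {L : Subring (SeqRing k)} (hL : ∀ x ∈ L, shift k x ∈ L)
    (h : IsPseudoField L ((shift k).restrict L L hL)) {x : SeqRing k} (hx : x ∈ L) :
    ∃ l, 0 < l ∧ IsDichotomous l x := by
  obtain ⟨l, _, e, he, hshift, hfield⟩ := h
  obtain ⟨f, rfl⟩ := mk_surjective x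
  choose E hE using fun i => mk_surjective (e i : SeqRing k)
  have hcyc : ∀ (t : ℕ) (i : Fin l), (shift k)^[t] (e i : SeqRing k) =
      e (i + Fin.ofNat l t) := by
    intro t
    induction t with
    | zero =>
      intro i
      have : Fin.ofNat l 0 = 0 := rfl
      rw [this, add_zero]
      rfl
    | succ t ih =>
      intro i
      have h1 : shift k (e i : SeqRing k) = e (i + 1) := congrArg Subtype.val (hshift i)
      rw [Function.iterate_succ_apply, h1, ih]
      congr 2
      rw [add_assoc]
      congr 1
      ext
      simp [Fin.val_add, Nat.add_comm]
  have hiter : ∀ (t : ℕ) (g : ℕ → k), (shift k)^[t] (mk g) = mk fun m => g (m + t) := by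
    intro t
    induction t with
    | zero => intro g; rfl
    | succ t ih =>
      intro g
      rw [Function.iterate_succ_apply, shift_mk, ih]
      congr 1
  -- Shifting `l` times brings the cyclic index back, so each idempotent is eventually `l`-periodic
  -- as a sequence.
  have hper : ∀ i, ∀ᶠ m in Filter.atTop, E i (m + l) = E i m := by
    intro i
    have h1 := hcyc l i
    have : Fin.ofNat l l = 0 := by ext; simp
    rw [this, add_zero, ← hE, hiter] at h1
    exact mk_eq_mk.mp h1
  have hidem : ∀ i, ∀ᶠ m in Filter.atTop, E i m * E i m = E i m := by
    intro i
    have h1 := congrArg (Subtype.val : L → SeqRing k) (he.idem i).eq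
    change (e i : SeqRing k) * e i = e i at h1
    rw [← hE, mk_mul] at h1
    exact mk_eq_mk.mp h1
  have hsum : ∀ᶠ m in Filter.atTop, ∑ i, E i m = 1 := by
    have h1 := congrArg L.subtype he.complete
    rw [map_sum, map_one] at h1
    have h2 : mkHom k (∑ i, E i) = mkHom k 1 := by
      rw [map_sum, map_one, ← h1]
      exact Finset.sum_congr rfl fun i _ => hE i
    filter_upwards [mk_eq_mk.mp (show mk _ = mk _ from h2)] with m hm
    rwa [Finset.sum_apply] at hm
  -- `eᵢ x` is either zero or invertible in the field `eᵢL`; in the latter case `f` has no zero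
  -- where `E i` is nonzero, eventually.
  have hdich : ∀ i, (∀ᶠ m in Filter.atTop, E i m * f m = 0) ∨
      (∀ᶠ m in Filter.atTop, E i m ≠ 0 → f m ≠ 0) := by
    intro i
    let a : (he.idem i).Corner := ⟨e i * ⟨mk f, hx⟩ * e i, ⟨_, rfl⟩⟩
    by_cases ha : a = 0
    · left
      have h1 : (e i : SeqRing k) * mk f * e i = 0 :=
        congrArg (fun x : (he.idem i).Corner => ((x.1 : L) : SeqRing k)) ha
      rw [← hE, mk_mul, mk_mul, mk_eq_zero] at h1
      filter_upwards [h1, hidem i] with m h2 h3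
      simp only [Pi.mul_apply] at h2
      rw [← h3]
      linear_combination h2
    · right
      obtain ⟨b, hb⟩ := (hfield i).mul_inv_cancel ha
      have h1 : (e i : SeqRing k) * mk f * e i * ((b.1 : L) : SeqRing k) = e i :=
        congrArg (fun x : (he.idem i).Corner => ((x.1 : L) : SeqRing k)) hb
      obtain ⟨g, hg⟩ := mk_surjective ((b.1 : L) : SeqRing k)
      rw [← hE, ← hg, mk_mul, mk_mul, mk_mul] at h1
      filter_upwards [mk_eq_mk.mp h1] with m h2 h3 h4
      simp only [Pi.mul_apply, h4, mul_zero, zero_mul] at h2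
      exact h3 h2.symm
  have hl : 0 < l := Nat.pos_of_neZero l
  refine ⟨l, hl, (isDichotomous_mk_iff hl).mpr ?_⟩
  -- The right side depends on `m` only through the values `E i m`, so it is eventually
  -- `l`-periodic.
  have hzero : ∀ᶠ m in Filter.atTop, (f m = 0 ↔
      ∃ i, E i m ≠ 0 ∧ ∀ᶠ m in Filter.atTop, E i m * f m = 0) := by
    have h1 : ∀ i, ∀ᶠ m in Filter.atTop, (∀ᶠ m in Filter.atTop, E i m * f m = 0) →
        E i m * f m = 0 := by
      intro i
      by_cases h : ∀ᶠ m in Filter.atTop, E i m * f m = 0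
      · exact h.mono fun m hm _ => hm
      · exact .of_forall fun m hm => absurd hm h
    have h2 : ∀ i, ∀ᶠ m in Filter.atTop, ¬ (∀ᶠ m in Filter.atTop, E i m * f m = 0) →
        E i m ≠ 0 → f m ≠ 0 := by
      intro i
      rcases hdich i with h | h
      · exact .of_forall fun m hm => absurd h hm
      · exact h.mono fun m hm _ => hm
    filter_upwards [Filter.eventually_all.mpr h1, Filter.eventually_all.mpr h2, hsum]
      with m h3 h4 h5
    constructor
    · intro h0
      obtain ⟨i, -, hi⟩ := Finset.exists_ne_zero_of_sum_ne_zero (h5.trans_ne one_ne_zero)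
      exact ⟨i, hi, by_contra fun h => h4 i h hi h0⟩
    · rintro ⟨i, hi, h⟩
      exact (mul_eq_zero.mp (h3 i h)).resolve_left hi
  filter_upwards [hzero, (Filter.tendsto_add_atTop_nat l).eventually hzero,
    Filter.eventually_all.mpr hper] with m h1 h2 h3
  simp only [h1, h2, h3]

end SeqRing

open SeqRing in
/-- All fundamental solution matrices in the ring of sequences have entries in a given
Picard–Vessiot extension. -/
theorem HasPicardVessiotInSeq.exists_subalgebra {k : Type*} [Field k] [CharZero k] {n : ℕ}
    {A : GL (Fin n) (RatFunc k)} (h : HasPicardVessiotInSeq A) (Y : GL (Fin n) (SeqRing k))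
    (hY : Y.val.map (shift k) = A.val.map (algebraMap (RatFunc k) (SeqRing k)) * Y.val) :
    ∃ L : Subalgebra (RatFunc k) (SeqRing k), (∀ i j, Y.val i j ∈ L) ∧
      (∀ i j, Y⁻¹.val i j ∈ L) ∧ ∀ x ∈ L, ∃ l, 0 < l ∧ IsDichotomous l x := by
  obtain ⟨L, hL, hPV⟩ := h
  obtain ⟨Z, hZ, -⟩ := hPV.exists_fundamental
  let W : GL (Fin n) (SeqRing k) := Matrix.GeneralLinearGroup.map L.val.toRingHom Z
  have hWL : ∀ i j, W.val i j ∈ L := fun i j => (Z.val i j).2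
  have hWinv : W⁻¹ = Matrix.GeneralLinearGroup.map L.val.toRingHom Z⁻¹ := (map_inv _ _).symm
  have hWL' : ∀ i j, W⁻¹.val i j ∈ L := fun i j => by
    rw [hWinv]
    exact (Z⁻¹.val i j).2
  have hW : W.val.map (shift k) = A.val.map (algebraMap (RatFunc k) (SeqRing k)) * W.val := by
    ext i j
    have h1 := congrArg L.val (congrFun (congrFun hZ i) j)
    rw [Matrix.mul_apply, map_sum] at h1
    rw [Matrix.mul_apply]
    exact h1
  let sh := Matrix.GeneralLinearGroup.map (n := Fin n) (shift k)
  let A' := Matrix.GeneralLinearGroup.map (n := Fin n) (algebraMap (RatFunc k) (SeqRing k)) A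
  have hY' : sh Y = A' * Y := Units.ext hY
  have hW' : sh W = A' * W := Units.ext hW
  -- Both matrices solve the same system, so their quotient is shift-invariant; its entries are
  -- constant sequences and lie in `k ⊆ L`.
  have hC : sh (W⁻¹ * Y) = W⁻¹ * Y := by
    rw [map_mul, map_inv, hY', hW']
    group
  have hCL : ∀ (C : GL (Fin n) (SeqRing k)), sh C = C → ∀ i j, C.val i j ∈ L := by
    intro C hC i j
    have h1 : shift k (C.val i j) = C.val i j :=
      congrArg (fun M : GL (Fin n) (SeqRing k) => M.val i j) hC
    obtain ⟨c, hc⟩ := exists_const_of_shift_eq h1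
    rw [hc, ← algebraMap_C]
    exact L.algebraMap_mem _
  have hmul : ∀ P Q : GL (Fin n) (SeqRing k), (∀ i j, P.val i j ∈ L) → (∀ i j, Q.val i j ∈ L) →
      ∀ i j, (P * Q).val i j ∈ L := by
    intro P Q hP hQ i j
    rw [Units.val_mul, Matrix.mul_apply]
    exact L.sum_mem fun m _ => L.mul_mem (hP _ _) (hQ _ _)
  refine ⟨L, ?_, ?_, fun x hx =>
    isDichotomous_of_pseudoField (L := L.toSubring) hL hPV.isPseudoField hx⟩
  · have : Y = W * (W⁻¹ * Y) := by group
    rw [this]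
    exact hmul _ _ hWL (hCL _ hC)
  · have : Y⁻¹ = (W⁻¹ * Y)⁻¹ * W⁻¹ := by group
    rw [this]
    exact hmul _ _ (hCL _ (by rw [map_inv, hC])) hWL'

/-! ### Orbits of the rational map and sequences -/

namespace SkewMap

open AffineRationalMap SeqRing

variable {k : Type*} [Field k] {n : ℕ}

/-- The first coordinate `z(x)` of a `k`-point `x`. -/
noncomputable def baseCoord (x : CoordRing k n →ₐ[k] k) : k := x (algebraMap k[X] (CoordRing k n) X)

variable (k n) in
/-- The generic matrix `Z` over the coordinate ring. -/
noncomputable def genericGL : GL (Fin n) (CoordRing k n) :=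
  Matrix.GeneralLinearGroup.mk'' ((genericMatrix k n).map (algebraMap _ (CoordRing k n))) (by
    have : ((genericMatrix k n).map (algebraMap _ (CoordRing k n))).det =
        algebraMap _ (CoordRing k n) (genericMatrix k n).det := by
      rw [RingHom.map_det]; rfl
    rw [this]
    exact IsLocalization.Away.algebraMap_isUnit (S := CoordRing k n) _)

theorem genericGL_apply (i j : Fin n) : (genericGL k n).val i j =
    algebraMap (MvPolynomial (Fin n × Fin n) k[X]) (CoordRing k n) (MvPolynomial.X (i, j)) := rfl

theorem algebraMap_det_genericMatrix :
    algebraMap _ (CoordRing k n) (genericMatrix k n).det = (genericGL k n).val.det := by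
  rw [RingHom.map_det]; rfl

theorem apply_algebraMap (x : CoordRing k n →ₐ[k] k) (p : k[X]) :
    x (algebraMap k[X] (CoordRing k n) p) = p.eval (baseCoord x) := by
  have : x.comp (IsScalarTower.toAlgHom k k[X] (CoordRing k n)) = Polynomial.aeval (baseCoord x) :=
    Polynomial.algHom_ext (by simp [baseCoord])
  have h := DFunLike.congr_fun this p
  rw [Polynomial.coe_aeval_eq_eval] at h
  exact h

theorem baseCoord_point (b : k) (B : GL (Fin n) k) : baseCoord (point b B) = b := by
  rw [baseCoord, IsScalarTower.algebraMap_apply k[X] (MvPolynomial (Fin n × Fin n) k[X])]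
  refine (IsLocalization.Away.lift_eq (S := CoordRing k n) (genericMatrix k n).det
    (pointAux_isUnit b B) _).trans ?_
  simp [pointAux, MvPolynomial.algebraMap_eq]

theorem comorphism_algebraMap (A : GL (Fin n) (RatFunc k))
    (g : MvPolynomial (Fin n × Fin n) k[X]) :
    comorphism A (algebraMap _ (CoordRing k n) g) = comorphismAux A g :=
  IsLocalization.Away.lift_eq (S := CoordRing k n) (genericMatrix k n).det
    (comorphismAux_isUnit A) g

theorem comorphism_X (A : GL (Fin n) (RatFunc k)) :
    comorphism A (algebraMap k[X] (CoordRing k n) X) =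
      algebraMap (CoordRing k n) (FunField k n) (algebraMap k[X] (CoordRing k n) X + 1) := by
  rw [IsScalarTower.algebraMap_apply k[X] (MvPolynomial (Fin n × Fin n) k[X]) (CoordRing k n),
    comorphism_algebraMap, ← IsScalarTower.algebraMap_apply, map_add, map_one,
    ← IsScalarTower.algebraMap_apply]
  simp [comorphismAux, MvPolynomial.algebraMap_eq]

theorem comorphism_genericGL (A : GL (Fin n) (RatFunc k)) (i j : Fin n) :
    comorphism A ((genericGL k n).val i j) = imageMatrix A i j := by
  rw [genericGL_apply, comorphism_algebraMap]
  simp [comorphismAux]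

theorem genericMatrixFun_apply (i j : Fin n) : genericMatrixFun k n i j =
    algebraMap (CoordRing k n) (FunField k n) ((genericGL k n).val i j) := by
  rw [genericGL_apply, ← IsScalarTower.algebraMap_apply, genericMatrixFun, Matrix.map_apply]
  rfl

theorem ratFuncHom_algebraMap (p : k[X]) : ratFuncHom k n (algebraMap k[X] (RatFunc k) p) =
    algebraMap (CoordRing k n) (FunField k n) (algebraMap k[X] (CoordRing k n) p) := by
  rw [← IsScalarTower.algebraMap_apply]
  have := RatFunc.liftAlgHom_apply_div (φ := IsScalarTower.toAlgHom k k[X] (FunField k n))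
    (nonZeroDivisors_le_comap_nonZeroDivisors_of_injective _ (algebraMap_injective k n)) p 1
  simpa [ratFuncHom] using this

/-- A common denominator of the entries of `A`. -/
theorem exists_common_denominator (A : Matrix (Fin n) (Fin n) (RatFunc k)) :
    ∃ q : k[X], q ≠ 0 ∧ ∃ P : Matrix (Fin n) (Fin n) k[X], ∀ i j,
      A i j * algebraMap k[X] (RatFunc k) q = algebraMap k[X] (RatFunc k) (P i j) := by
  obtain ⟨q, hq⟩ := IsLocalization.exist_integer_multiples_of_finite (nonZeroDivisors k[X])
    (fun p : Fin n × Fin n => A p.1 p.2)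
  choose P hP using hq
  refine ⟨q, nonZeroDivisors.ne_zero q.2, fun i j => P (i, j), fun i j => ?_⟩
  rw [hP (i, j), Algebra.smul_def, mul_comm]

/-! ### Domain of definition of the rational map and its effect on coordinates -/

/-- The elements of the function field that are regular on `D(s)`. -/
def regularSubring (k : Type*) [Field k] (n : ℕ) (s : CoordRing k n) : Subring (FunField k n) where
  carrier := {r | ∃ (a : CoordRing k n) (m : ℕ), r * algebraMap _ (FunField k n) (s ^ m) =
    algebraMap _ (FunField k n) a}
  mul_mem' := by
    rintro r t ⟨a, m, h⟩ ⟨b, l, h'⟩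
    exact ⟨a * b, m + l, by rw [pow_add, map_mul, map_mul, ← h, ← h']; ring⟩
  one_mem' := ⟨1, 0, by simp⟩
  add_mem' := by
    rintro r t ⟨a, m, h⟩ ⟨b, l, h'⟩
    exact ⟨a * s ^ l + s ^ m * b, m + l, by
      rw [pow_add, map_mul, map_add, map_mul, map_mul, ← h, ← h']; ring⟩
  zero_mem' := ⟨0, 0, by simp⟩
  neg_mem' := by
    rintro r ⟨a, m, h⟩
    exact ⟨-a, m, by rw [map_neg, ← h]; ring⟩

theorem algebraMap_mem_regularSubring (s a : CoordRing k n) :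
    algebraMap _ (FunField k n) a ∈ regularSubring k n s := ⟨a, 0, by simp⟩

theorem det_mem_subring {R : Type*} [CommRing R] (S : Subring R) (M : Matrix (Fin n) (Fin n) R)
    (h : ∀ i j, M i j ∈ S) : M.det ∈ S := by
  rw [Matrix.det_apply]
  exact S.sum_mem fun σ _ => S.zsmul_mem (S.prod_mem fun i _ => h _ _) _

theorem ratFuncHom_mem_regularSubring {h : RatFunc k} {p q : k[X]}
    (hpq : h * algebraMap k[X] (RatFunc k) q = algebraMap k[X] (RatFunc k) p) :
    ratFuncHom k n h ∈ regularSubring k n (algebraMap k[X] (CoordRing k n) q) :=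
  ⟨algebraMap k[X] (CoordRing k n) p, 1, by
    rw [pow_one, ← ratFuncHom_algebraMap, ← ratFuncHom_algebraMap, ← map_mul, hpq]⟩

/-- An element of the coordinate ring is a polynomial in `z` and `Z` up to a power of `det Z`. -/
theorem exists_mul_det_pow (f : CoordRing k n) :
    ∃ (m : ℕ) (g : MvPolynomial (Fin n × Fin n) k[X]),
      f * (genericGL k n).val.det ^ m = algebraMap _ (CoordRing k n) g := by
  obtain ⟨m, g, h⟩ := IsLocalization.Away.surj (genericMatrix k n).det f
  exact ⟨m, g, by rw [← h, algebraMap_det_genericMatrix]⟩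

/-- The rational map is defined where a common denominator of `A` and `A⁻¹` does not vanish. -/
theorem isDefinedOnBasicOpen_comorphism (A : GL (Fin n) (RatFunc k)) {q : k[X]}
    {P P' : Matrix (Fin n) (Fin n) k[X]}
    (hP : ∀ i j, A.val i j * algebraMap k[X] (RatFunc k) q = algebraMap k[X] (RatFunc k) (P i j))
    (hP' : ∀ i j, A⁻¹.val i j * algebraMap k[X] (RatFunc k) q =
      algebraMap k[X] (RatFunc k) (P' i j)) :
    IsDefinedOnBasicOpen (comorphism A) (algebraMap k[X] (CoordRing k n) q) := by
  set T := regularSubring k n (algebraMap k[X] (CoordRing k n) q)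
  suffices h : ∀ f, comorphism A f ∈ T from h
  have hZ : ∀ i j, genericMatrixFun k n i j ∈ T := fun i j => by
    rw [genericMatrixFun_apply]
    exact algebraMap_mem_regularSubring _ _
  have himage : ∀ i j, imageMatrix A i j ∈ T := fun i j => by
    rw [imageMatrix, Matrix.mul_apply]
    exact T.sum_mem fun l _ => T.mul_mem (ratFuncHom_mem_regularSubring (hP i l)) (hZ l j)
  have hpoly : ∀ g, comorphism A (algebraMap (MvPolynomial (Fin n × Fin n) k[X]) _ g) ∈ T := by
    intro g
    rw [comorphism_algebraMap]
    induction g using MvPolynomial.induction_on with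
    | C p =>
      have hp : comorphismAux A (MvPolynomial.C p) =
          Polynomial.aeval (algebraMap k[X] (FunField k n) X + 1) p := by
        simp [comorphismAux]
      rw [hp, Polynomial.aeval_eq_sum_range]
      refine T.sum_mem fun i _ => ?_
      rw [Algebra.smul_def, IsScalarTower.algebraMap_apply k (CoordRing k n) (FunField k n),
        IsScalarTower.algebraMap_apply k[X] (CoordRing k n) (FunField k n)]
      exact T.mul_mem (algebraMap_mem_regularSubring _ _)
        (T.pow_mem (T.add_mem (algebraMap_mem_regularSubring _ _) T.one_mem) _)
    | add p q hp hq => rw [map_add]; exact T.add_mem hp hq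
    | mul_X p i hp =>
      rw [map_mul]
      refine T.mul_mem hp ?_
      simpa [comorphismAux] using himage i.1 i.2
  -- `det Z` is inverted in the coordinate ring, so its image `det A * det Z` needs a regular
  -- inverse; this is where the denominators of `A⁻¹` enter.
  obtain ⟨w, hw, hw1⟩ : ∃ w ∈ T, comorphism A (genericGL k n).val.det * w = 1 := by
    refine ⟨(A⁻¹.val.map (ratFuncHom k n)).det *
      algebraMap _ (FunField k n) ((genericGL k n)⁻¹).val.det,
      T.mul_mem (det_mem_subring T _ fun i j => ratFuncHom_mem_regularSubring (hP' i j))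
        (algebraMap_mem_regularSubring _ _), ?_⟩
    have h1 : comorphism A (genericGL k n).val.det = (imageMatrix A).det := by
      rw [AlgHom.map_det]
      congr 1
      ext i j
      exact comorphism_genericGL A i j
    have h2 : (genericMatrixFun k n).det =
        algebraMap _ (FunField k n) (genericGL k n).val.det := by
      rw [RingHom.map_det]
      congr 1
    have h3 : (A.val.map (ratFuncHom k n)).det * (A⁻¹.val.map (ratFuncHom k n)).det = 1 := by
      have := map_mul (Matrix.GeneralLinearGroup.map (n := Fin n) (ratFuncHom k n).toRingHom) A A⁻¹
      rw [mul_inv_cancel, map_one] at this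
      rw [← Matrix.det_mul]
      exact (congrArg Matrix.det (congrArg Units.val this).symm).trans Matrix.det_one
    have h4 : (genericGL k n).val.det * ((genericGL k n)⁻¹).val.det = 1 := by
      rw [← Matrix.det_mul, ← Units.val_mul, mul_inv_cancel, Units.val_one, Matrix.det_one]
    rw [h1, imageMatrix, Matrix.det_mul, h2, mul_mul_mul_comm, h3, ← map_mul, h4, map_one, one_mul]
  intro f
  obtain ⟨m, g, h⟩ := exists_mul_det_pow f
  have h1 := congrArg (comorphism A) h
  rw [map_mul, map_pow] at h1
  have h2 : comorphism A f = comorphism A (algebraMap _ _ g) * w ^ m := by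
    rw [← h1, mul_assoc, ← mul_pow, hw1, one_pow, mul_one]
  rw [h2]
  exact T.mul_mem (hpoly g) (T.pow_mem hw m)

theorem toPrime_mem_domain {A : GL (Fin n) (RatFunc k)} {q : k[X]}
    (hq : IsDefinedOnBasicOpen (comorphism A) (algebraMap k[X] (CoordRing k n) q))
    {x : CoordRing k n →ₐ[k] k} (hx : q.eval (baseCoord x) ≠ 0) :
    toPrime x ∈ domain (comorphism A) :=
  TopologicalSpace.Opens.mem_iSup.mpr ⟨⟨_, hq⟩, fun h => hx (by
    rw [← apply_algebraMap]
    exact RingHom.mem_ker.mp h)⟩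

theorem step_apply {A : GL (Fin n) (RatFunc k)} {x : CoordRing k n →ₐ[k] k}
    (hx : toPrime x ∈ domain (comorphism A)) (f : CoordRing k n) :
    step (comorphism A) x f = valueAt x (comorphism A f) := by
  rw [step, dif_pos hx]
  rfl

theorem baseCoord_step {A : GL (Fin n) (RatFunc k)} {x : CoordRing k n →ₐ[k] k}
    (hx : toPrime x ∈ domain (comorphism A)) :
    baseCoord (step (comorphism A) x) = baseCoord x + 1 := by
  rw [baseCoord, step_apply hx, comorphism_X, valueAt_eq x (s := 1)
    (a := algebraMap k[X] (CoordRing k n) X + 1) (by simp) (by simp)]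
  simp [baseCoord]

/-- The relation `σ(Z) = AZ` with denominators cleared, so that only polynomials are evaluated at
the point. -/
theorem genericGL_step {A : GL (Fin n) (RatFunc k)} {x : CoordRing k n →ₐ[k] k}
    (hx : toPrime x ∈ domain (comorphism A)) {q : k[X]} {P : Matrix (Fin n) (Fin n) k[X]}
    (hP : ∀ i j, A.val i j * algebraMap k[X] (RatFunc k) q = algebraMap k[X] (RatFunc k) (P i j))
    (hq : q.eval (baseCoord x) ≠ 0) (i j : Fin n) :
    q.eval (baseCoord x) * step (comorphism A) x ((genericGL k n).val i j) =
      ∑ l, (P i l).eval (baseCoord x) * x ((genericGL k n).val l j) := by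
  rw [step_apply hx, comorphism_genericGL,
    valueAt_eq x (s := algebraMap k[X] (CoordRing k n) q)
      (a := ∑ l, algebraMap k[X] (CoordRing k n) (P i l) * (genericGL k n).val l j)
      (by rwa [apply_algebraMap])]
  · rw [apply_algebraMap, mul_div_cancel₀ _ hq, map_sum]
    simp [apply_algebraMap]
  · rw [imageMatrix, Matrix.mul_apply, Finset.sum_mul, map_sum]
    refine Finset.sum_congr rfl fun l _ => ?_
    rw [map_mul, ← ratFuncHom_algebraMap, ← ratFuncHom_algebraMap, ← hP, map_mul,
      genericMatrixFun_apply, Matrix.map_apply]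
    ring

theorem baseCoord_iterate {A : GL (Fin n) (RatFunc k)} {x : CoordRing k n →ₐ[k] k}
    (hx : OrbitDefined (comorphism A) x) (i : ℕ) :
    baseCoord ((step (comorphism A))^[i] x) = baseCoord x + i := by
  induction i with
  | zero => simp
  | succ i ih =>
    rw [Function.iterate_succ_apply', baseCoord_step (hx i), ih]
    push_cast
    ring

/-! ### Orbit sequences -/

/-- The sequence of values of `f` along the orbit of `x`, where the index is the first
coordinate of the point if that of `x` is `b`. -/
noncomputable def orbitSeq (A : GL (Fin n) (RatFunc k)) (x : CoordRing k n →ₐ[k] k) (b : ℕ) :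
    CoordRing k n →+* SeqRing k :=
  (mkHom k).comp (RingHom.pi fun m => ((step (comorphism A))^[m - b] x).toRingHom)

theorem orbitSeq_apply (A : GL (Fin n) (RatFunc k)) (x : CoordRing k n →ₐ[k] k) (b : ℕ)
    (f : CoordRing k n) : orbitSeq A x b f = mk fun m => (step (comorphism A))^[m - b] x f := rfl

theorem eventuallyPeriodic_zeros_iff (A : GL (Fin n) (RatFunc k)) (x : CoordRing k n →ₐ[k] k)
    (b : ℕ) (f : CoordRing k n) :
    EventuallyPeriodic {i | (step (comorphism A))^[i] x f = 0} ↔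
      ∃ l, 0 < l ∧ IsDichotomous l (orbitSeq A x b f) := by
  rw [orbitSeq_apply, exists_isDichotomous_mk_iff,
    ← EventuallyPeriodic.preimage_add_iff (S := {m | (step (comorphism A))^[m - b] x f = 0}) b]
  simp only [Set.mem_ofPred_eq, Nat.add_sub_cancel]

theorem returnSet_zeroLocus (A : GL (Fin n) (RatFunc k)) (x : CoordRing k n →ₐ[k] k)
    (T : Set (CoordRing k n)) :
    returnSet (comorphism A) x (PrimeSpectrum.zeroLocus T) =
      {i | ∀ f ∈ T, (step (comorphism A))^[i] x f = 0} := rfl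

variable [CharZero k]

/-- Indexing by the first coordinate rather than by time makes a polynomial in `z` take the value
`p(m)` at `m`. The truncated subtraction `m - b` matters only for `m < b`, which the class of the
sequence ignores. -/
theorem orbitSeq_algebraMap {A : GL (Fin n) (RatFunc k)} {x : CoordRing k n →ₐ[k] k} {b : ℕ}
    (hb : baseCoord x = b) (hx : OrbitDefined (comorphism A) x) (p : k[X]) :
    orbitSeq A x b (algebraMap k[X] (CoordRing k n) p) =
      algebraMap (RatFunc k) (SeqRing k) (algebraMap k[X] (RatFunc k) p) := by
  rw [algebraMap_polynomial, orbitSeq_apply, mk_eq_mk]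
  filter_upwards [Filter.eventually_ge_atTop b] with m hm
  rw [apply_algebraMap, baseCoord_iterate hx, hb, ← Nat.cast_add, Nat.add_sub_cancel' hm]

/-- An orbit gives a fundamental solution matrix in the ring of sequences. -/
theorem shift_orbitSeq {A : GL (Fin n) (RatFunc k)} {x : CoordRing k n →ₐ[k] k} {b : ℕ}
    (hb : baseCoord x = b) (hx : OrbitDefined (comorphism A) x) :
    ((genericGL k n).map (orbitSeq A x b)).val.map (shift k) =
      A.val.map (algebraMap (RatFunc k) (SeqRing k)) *
        ((genericGL k n).map (orbitSeq A x b)).val := by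
  obtain ⟨q, hq0, P, hP⟩ := exists_common_denominator A.val
  have hqu : IsUnit (algebraMap (RatFunc k) (SeqRing k) (algebraMap k[X] (RatFunc k) q)) :=
    (IsUnit.mk0 _ (by simpa using hq0)).map _
  ext i j
  -- A nonzero polynomial is a unit among sequences, so the equation may be checked after
  -- multiplying by the common denominator `q`.
  refine hqu.mul_right_injective ?_
  rw [Matrix.mul_apply]
  simp only [Finset.mul_sum]
  have h1 : ∀ l, algebraMap (RatFunc k) (SeqRing k) (algebraMap k[X] (RatFunc k) q) *
      (A.val.map (algebraMap (RatFunc k) (SeqRing k)) i l *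
        ((genericGL k n).map (orbitSeq A x b)).val l j) =
      orbitSeq A x b (algebraMap k[X] (CoordRing k n) (P i l) * (genericGL k n).val l j) := by
    intro l
    rw [map_mul, orbitSeq_algebraMap hb hx, ← hP, map_mul, Matrix.map_apply]
    change _ * (_ * orbitSeq A x b ((genericGL k n).val l j)) = _
    ring
  rw [Finset.sum_congr rfl fun l _ => h1 l, ← map_sum, algebraMap_polynomial]
  change mk _ * shift k (orbitSeq A x b ((genericGL k n).val i j)) = _
  rw [orbitSeq_apply, orbitSeq_apply, shift_mk, mk_mul, mk_eq_mk]
  filter_upwards [eventually_eval_ne_zero hq0, Filter.eventually_ge_atTop b] with m hm hbm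
  have hbase : baseCoord ((step (comorphism A))^[m - b] x) = m := by
    rw [baseCoord_iterate hx, hb, ← Nat.cast_add, Nat.add_sub_cancel' hbm]
  have h2 := genericGL_step (hx (m - b)) hP (by rwa [hbase, ← Polynomial.eval₂_id]) i j
  rw [hbase, ← Function.iterate_succ_apply' (step (comorphism A))] at h2
  rw [Pi.mul_apply, Nat.sub_add_comm hbm, h2, map_sum]
  simp [apply_algebraMap, hbase]

/-- There are points with a defined orbit. -/
theorem exists_orbitDefined (A : GL (Fin n) (RatFunc k)) :
    ∃ b : ℕ, ∀ B : GL (Fin n) k, OrbitDefined (comorphism A) (point (b : k) B) := by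
  obtain ⟨q, hq, P, hP⟩ := exists_common_denominator A.val
  obtain ⟨r, hr, Q, hQ⟩ := exists_common_denominator A⁻¹.val
  have hdef := isDefinedOnBasicOpen_comorphism A (q := q * r) (P := fun i j => P i j * r)
    (P' := fun i j => Q i j * q)
    (fun i j => by rw [map_mul, map_mul, ← hP]; ring)
    (fun i j => by rw [map_mul, map_mul, ← hQ]; ring)
  -- In characteristic zero `q * r` has finitely many zeros among the natural numbers; `b` lies
  -- beyond all of them.
  obtain ⟨b, hb⟩ := Filter.eventually_atTop.mp (eventually_eval_ne_zero (mul_ne_zero hq hr))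
  refine ⟨b, fun B => ?_⟩
  -- The coordinate formula requires the earlier points to lie in the domain, and membership follows
  -- from the coordinate, so both are proved in one induction.
  have key : ∀ i : ℕ, baseCoord ((step (comorphism A))^[i] (point (b : k) B)) = (b + i : ℕ) := by
    intro i
    induction i with
    | zero => simp [baseCoord_point]
    | succ i ih =>
      rw [Function.iterate_succ_apply', baseCoord_step, ih]
      · push_cast
        ring
      · refine toPrime_mem_domain hdef ?_
        rw [ih, ← Polynomial.eval₂_id]
        exact hb _ (Nat.le_add_right b i)
  intro i
  refine toPrime_mem_domain hdef ?_
  rw [key i, ← Polynomial.eval₂_id]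
  exact hb _ (Nat.le_add_right b i)

/-- Brings the zeros of an arbitrary element of `k(z)[Yᵢⱼ]` back to those of a regular function
along the orbit, since multiplying by a nonzero polynomial alters only finitely many zeros. -/
theorem exists_mul_eq_orbitSeq {A : GL (Fin n) (RatFunc k)} {x : CoordRing k n →ₐ[k] k} {b : ℕ}
    (hb : baseCoord x = b) (hx : OrbitDefined (comorphism A) x) {s : SeqRing k}
    (hs : s ∈ Algebra.adjoin (RatFunc k) (Set.range fun p : Fin n × Fin n =>
      ((genericGL k n).map (orbitSeq A x b)).val p.1 p.2)) :
    ∃ (q : k[X]) (f : CoordRing k n), q ≠ 0 ∧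
      s * algebraMap (RatFunc k) (SeqRing k) (algebraMap k[X] (RatFunc k) q) =
        orbitSeq A x b f := by
  induction hs using Algebra.adjoin_induction with
  | mem s hs =>
    obtain ⟨⟨i, j⟩, rfl⟩ := hs
    exact ⟨1, (genericGL k n).val i j, one_ne_zero, by rw [map_one, map_one, mul_one]; rfl⟩
  | algebraMap r =>
    refine ⟨r.denom, algebraMap k[X] (CoordRing k n) r.num, r.denom_ne_zero, ?_⟩
    rw [orbitSeq_algebraMap hb hx, ← map_mul]
    congr 1
    have h0 : algebraMap k[X] (RatFunc k) r.denom ≠ 0 := by simpa using r.denom_ne_zero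
    conv_lhs => rw [← RatFunc.num_div_denom r]
    rw [RatFunc.num_div_denom, ← div_eq_iff h0 |>.mp (RatFunc.num_div_denom r)]
  | add s t _ _ hs ht =>
    obtain ⟨q, f, hq, h⟩ := hs
    obtain ⟨r, g, hr, h'⟩ := ht
    refine ⟨q * r, f * algebraMap k[X] _ r + g * algebraMap k[X] _ q, mul_ne_zero hq hr, ?_⟩
    rw [map_add, map_mul, map_mul (orbitSeq A x b), ← h, orbitSeq_algebraMap hb hx,
      map_mul (orbitSeq A x b), ← h', orbitSeq_algebraMap hb hx, map_mul]
    ring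
  | mul s t _ _ hs ht =>
    obtain ⟨q, f, hq, h⟩ := hs
    obtain ⟨r, g, hr, h'⟩ := ht
    refine ⟨q * r, f * g, mul_ne_zero hq hr, ?_⟩
    rw [map_mul, map_mul, map_mul, ← h, ← h']
    ring

/-- Only the return sets of the hypersurfaces `f = 0` are needed. -/
theorem hasPicardVessiotInSeq_of_orbit {A : GL (Fin n) (RatFunc k)} {x : CoordRing k n →ₐ[k] k}
    {b : ℕ} (hb : baseCoord x = b) (hx : OrbitDefined (comorphism A) x)
    (h : ∀ Y : Set (PrimeSpectrum (CoordRing k n)), IsClosed Y →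
      IsFiniteUnionOfAP (returnSet (comorphism A) x Y)) : HasPicardVessiotInSeq A := by
  refine hasPicardVessiotInSeq_of_isDichotomous _ (shift_orbitSeq hb hx) fun s hs => ?_
  obtain ⟨q, f, hq, hqs⟩ := exists_mul_eq_orbitSeq hb hx hs
  have h1 := h _ (PrimeSpectrum.isClosed_zeroLocus {f})
  rw [isFiniteUnionOfAP_iff_eventuallyPeriodic, returnSet_zeroLocus] at h1
  simp only [Set.mem_singleton_iff, forall_eq] at h1
  obtain ⟨l, hl, h2⟩ := (eventuallyPeriodic_zeros_iff A x b f).mp h1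
  rw [← hqs] at h2
  exact ⟨l, hl, h2.of_mul_isUnit hl ((IsUnit.mk0 _ (by simpa using hq)).map _)⟩

/-- `L` contains the entries of the orbit's fundamental matrix and of its inverse, hence the orbit
sequence of every regular function, including those with powers of `det Z` in the denominator. Since
the coordinate ring is noetherian, a closed set is cut out by finitely many functions, and eventual
periodicity survives finite intersections. -/
theorem isFiniteUnionOfAP_returnSet {A : GL (Fin n) (RatFunc k)} {x : CoordRing k n →ₐ[k] k}
    {b : ℕ} (hb : baseCoord x = b) (hx : OrbitDefined (comorphism A) x)
    (h : HasPicardVessiotInSeq A) {Y : Set (PrimeSpectrum (CoordRing k n))} (hY : IsClosed Y) :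
    IsFiniteUnionOfAP (returnSet (comorphism A) x Y) := by
  obtain ⟨L, hL, hL', hd⟩ := h.exists_subalgebra _ (shift_orbitSeq hb hx)
  set W := (genericGL k n).map (orbitSeq A x b)
  have hpoly : ∀ g, orbitSeq A x b
      (algebraMap (MvPolynomial (Fin n × Fin n) k[X]) (CoordRing k n) g) ∈ L := by
    intro g
    induction g using MvPolynomial.induction_on with
    | C p =>
      rw [← MvPolynomial.algebraMap_eq, ← IsScalarTower.algebraMap_apply,
        orbitSeq_algebraMap hb hx]
      exact L.algebraMap_mem _
    | add p q hp hq => rw [map_add, map_add]; exact L.add_mem hp hq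
    | mul_X p i hp => rw [map_mul, map_mul]; exact L.mul_mem hp (hL i.1 i.2)
  have hmem : ∀ f, orbitSeq A x b f ∈ L := by
    intro f
    obtain ⟨m, g, hfg⟩ := exists_mul_det_pow f
    have h1 : orbitSeq A x b (genericGL k n).val.det = W.val.det := by
      rw [RingHom.map_det]; rfl
    have h2 : W.val.det * W⁻¹.val.det = 1 := by
      rw [← Matrix.det_mul, ← Units.val_mul, mul_inv_cancel, Units.val_one, Matrix.det_one]
    have h3 := congrArg (orbitSeq A x b) hfg
    rw [map_mul, map_pow, h1] at h3
    have h4 : orbitSeq A x b f = orbitSeq A x b (algebraMap _ _ g) * W⁻¹.val.det ^ m := by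
      rw [← h3, mul_assoc, ← mul_pow, h2, one_pow, mul_one]
    rw [h4]
    exact L.mul_mem (hpoly g) (L.pow_mem (det_mem_subring L.toSubring _ hL') m)
  obtain ⟨T, rfl⟩ := (PrimeSpectrum.isClosed_iff_zeroLocus_ideal Y).mp hY
  have : IsNoetherianRing (CoordRing k n) :=
    IsLocalization.isNoetherianRing (Submonoid.powers (genericMatrix k n).det) _ inferInstance
  obtain ⟨F, hF⟩ := IsNoetherian.noetherian T
  rw [isFiniteUnionOfAP_iff_eventuallyPeriodic]
  have hset : returnSet (comorphism A) x (PrimeSpectrum.zeroLocus (T : Set (CoordRing k n))) =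
      ⋂ f ∈ F, {i | (step (comorphism A))^[i] x f = 0} := by
    have : T = Ideal.span (F : Set (CoordRing k n)) := hF.symm
    rw [this, PrimeSpectrum.zeroLocus_span, returnSet_zeroLocus]
    ext i
    simp
  refine (EventuallyPeriodic.biInter_finset F fun f _ => ?_ : EventuallyPeriodic
    (⋂ f ∈ F, {i | (step (comorphism A))^[i] x f = 0})).congr (.of_forall fun i => ?_)
  · exact (eventuallyPeriodic_zeros_iff A x b f).mpr (hd _ (hmem f))
  · exact (Set.ext_iff.mp hset i).symm

end SkewMap

/-! ### The equivalence -/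

open SkewMap in
theorem mainTheorem1 {k : Type*} [Field k] [CharZero k] {n : ℕ} (A : GL (Fin n) (RatFunc k)) :
    List.TFAE [
      ∀ (b : ℕ) (B : GL (Fin n) k),
        AffineRationalMap.OrbitDefined (SkewMap.comorphism A) (SkewMap.point (b : k) B) →
        ∀ Y : Set (PrimeSpectrum (SkewMap.CoordRing k n)), IsClosed Y →
          IsFiniteUnionOfAP
            (AffineRationalMap.returnSet (SkewMap.comorphism A) (SkewMap.point (b : k) B) Y),
      ∃ (b : ℕ) (B : GL (Fin n) k),
        AffineRationalMap.OrbitDefined (SkewMap.comorphism A) (SkewMap.point (b : k) B) ∧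
        ∀ Y : Set (PrimeSpectrum (SkewMap.CoordRing k n)), IsClosed Y →
          IsFiniteUnionOfAP
            (AffineRationalMap.returnSet (SkewMap.comorphism A) (SkewMap.point (b : k) B) Y),
      HasPicardVessiotInSeq A] := by
  tfae_have 1 → 2 := by
    intro h
    obtain ⟨b, hb⟩ := exists_orbitDefined A
    exact ⟨b, 1, hb 1, h b 1 (hb 1)⟩
  tfae_have 2 → 3 := by
    rintro ⟨b, B, hdef, h⟩
    exact hasPicardVessiotInSeq_of_orbit (baseCoord_point _ B) hdef h
  tfae_have 3 → 1 := by
    intro h b B hdef Y hY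
    exact isFiniteUnionOfAP_returnSet (baseCoord_point _ B) hdef h hY
  tfae_finish
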